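/- Let $f=(f_1,f_2):\mathbb{C}^2\to\mathbb{C}^2$ be a polynomial map of degree $d=\max(\deg f_1,\deg f_2)$, let $\|\cdot\|$ be the Euclidean norm, regard $\mathbb{C}^2$ as $\mathbb{P}^2\setminus L_\infty$ through $(z,w)\mapsto[z:w:1]$, and let $I(f)\subset\mathbb{P}^2$ be the indeterminacy set of the rational extension of $f$ to $\mathbb{P}^2$ (also denoted by $f$). Assume: (i) $L_\infty$ is attracting: there are $c>1$ and $R$ such that $\|f(p)\|\ge c\|p\|$ for all $p\in\mathbb{C}^2$ with $\|p\|\ge R$; (ii) $f(L_\infty\setminus I(f))=\{X\}$ is a single point, and $X\notin I(f)$; (iii) $V$ is a closed neighborhood of $X$ in $\mathbb{P}^2$ with $V\cap I(f)=\emptyset$, and for every point $x\in I(f)$ there are a real number $\ell_x\ge 1$, constants $C_1,C_2>0$ and a neighborhood $U$ of $x$ in $\mathbb{P}^2$ such that $$C_1\|p\|^{\ell_x}\le\|f(p)\|\le C_2\|p\|^{\ell_x}\quad\text{for all } p\in U\cap\mathbb{C}^2 \text{ with } f(p)\notin V .$$ For $p\in\mathbb{C}^2$ define the upper and lower escape rates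 by $$\log\overline{\ell}(p)=\limsup_{n\to\infty}\frac1n\log^+\log^+\|f^n(p)\|,\qquad \log\underline{\ell}(p)=\liminf_{n\to\infty}\frac1n\log^+\log^+\|f^n(p)\| ,$$ and say that $p$ has escape rate $\ell(p)=r$ if $\underline{\ell}(p)=\overline{\ell}(p)=r$. Say that $p$ escapes to infinity if $\|f^n(p)\|\to\infty$, and let the basin of $X$ be the set of $p\in\mathbb{C}^2$ with $f^n(p)\to X$ in $\mathbb{P}^2$. Then $a=\min_{x\in I(f)}\ell_x$ and $b=\max_{x\in I(f)}\ell_x$ exist, $b\le d-1$, and $$\{\overline{\ell}(p): p \text{ escapes to infinity}\}=[a,b]\cup\{d\}.$$ The set of values of the escape rate $\ell(p)$, over the points $p$ that escape to infinity and have an escape rate, is also exactly $[a,b]\cup\{d\}$. Moreover, for every $p\in\mathbb{C}^2$, one has $\overline{\ell}(p)=d$ if and only if $p$ is in the basin of $X$, and $p$ has escape rate $d$ if and only if $p$ is in the basin of $X$. -/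

import Mathlib

open Filter Topology
open scoped LinearAlgebra.Projectivization

namespace EscapeRates

/-- The affine plane with its Euclidean (Hermitian) norm. -/
abbrev C2 : Type := EuclideanSpace ℂ (Fin 2)

/-- The complex projective plane, with homogeneous coordinates `[Z : W : T]`. -/
abbrev P2 : Type := ℙ ℂ (Fin 3 → ℂ)

/-- The usual topology of the projective plane, as a quotient of the nonzero vectors. -/
noncomputable instance instTopologicalSpaceP2 : TopologicalSpace P2 :=
  TopologicalSpace.coinduced
    (Projectivization.mk' ℂ : {v : Fin 3 → ℂ // v ≠ 0} → P2) inferInstance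

/-- The embedding of the affine plane in the projective plane, `(z, w) ↦ [z : w : 1]`. -/
noncomputable def toP2 (p : C2) : P2 :=
  Projectivization.mk ℂ ![p 0, p 1, 1] (fun h => one_ne_zero (congrFun h 2))

/-- The line at infinity `T = 0`. -/
def lineAtInfinity : Set P2 := {x | x.rep 2 = 0}

/-- A pair `f = (f₁, f₂)` of polynomials in two variables, as a self-map of the plane. -/
noncomputable def polyMap (f : Fin 2 → MvPolynomial (Fin 2) ℂ) (p : C2) : C2 :=
  WithLp.toLp 2 (fun i => MvPolynomial.eval (fun j => p j) (f i))

/-- The degree of the polynomial map `f = (f₁, f₂)`. -/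
noncomputable def mapDegree (f : Fin 2 → MvPolynomial (Fin 2) ℂ) : ℕ :=
  max (f 0).totalDegree (f 1).totalDegree

/-- The value at `(Z, W, T)` of `T ^ d * g (Z / T, W / T)`, for `g` of degree at most `d`. -/
noncomputable def homogenizedEval (d : ℕ) (g : MvPolynomial (Fin 2) ℂ) (v : Fin 3 → ℂ) : ℂ :=
  ∑ k ∈ Finset.range (d + 1),
    v 2 ^ (d - k) * MvPolynomial.eval ![v 0, v 1] (MvPolynomial.homogeneousComponent k g)

/-- The homogeneous lift `(T ^ d f₁ (Z/T, W/T), T ^ d f₂ (Z/T, W/T), T ^ d)` of a polynomial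
map of degree `d`. Its three components have no common factor. -/
noncomputable def homLift (f : Fin 2 → MvPolynomial (Fin 2) ℂ) (v : Fin 3 → ℂ) : Fin 3 → ℂ :=
  ![homogenizedEval (mapDegree f) (f 0) v, homogenizedEval (mapDegree f) (f 1) v,
    v 2 ^ mapDegree f]

/-- The lift is homogeneous, so that the definitions below do not depend on the choice of
homogeneous coordinates. -/
theorem homLift_smul (f : Fin 2 → MvPolynomial (Fin 2) ℂ) (t : ℂ) (v : Fin 3 → ℂ) :
    homLift f (t • v) = t ^ mapDegree f • homLift f v := by
  have key : ∀ (d : ℕ) (g : MvPolynomial (Fin 2) ℂ),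
      homogenizedEval d g (t • v) = t ^ d * homogenizedEval d g v := by
    intro d g
    unfold homogenizedEval
    rw [Finset.mul_sum]
    refine Finset.sum_congr rfl fun k hk => ?_
    have hkd : k ≤ d := Nat.lt_succ_iff.mp (Finset.mem_range.mp hk)
    have h1 : (![(t • v) 0, (t • v) 1] : Fin 2 → ℂ) = t • ![v 0, v 1] := by
      ext i; fin_cases i <;> simp
    have h2 : MvPolynomial.eval (t • ![v 0, v 1]) (MvPolynomial.homogeneousComponent k g)
        = t ^ k * MvPolynomial.eval ![v 0, v 1] (MvPolynomial.homogeneousComponent k g) := by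
      rw [MvPolynomial.eval_eq', MvPolynomial.eval_eq', Finset.mul_sum]
      refine Finset.sum_congr rfl fun m hm => ?_
      have hm' := MvPolynomial.homogeneousComponent_isHomogeneous k g
        (MvPolynomial.mem_support_iff.mp hm)
      have hs : k = m 0 + m 1 := by
        rw [← hm', Finsupp.weight_apply, Finsupp.sum_fintype] <;> simp
      have ht : t ^ k = t ^ m 0 * t ^ m 1 := by rw [hs, pow_add]
      simp only [Fin.prod_univ_two, Pi.smul_apply, smul_eq_mul, mul_pow, ht]
      ring
    rw [h1, h2, Pi.smul_apply, smul_eq_mul, mul_pow]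
    have h3 : t ^ d = t ^ (d - k) * t ^ k := by rw [← pow_add, Nat.sub_add_cancel hkd]
    rw [h3]; ring
  unfold homLift
  ext i
  fin_cases i <;> simp [key, mul_pow]

/-- The indeterminacy set `I(f)` of the rational extension of `f` to the projective plane. -/
def indeterminacySet (f : Fin 2 → MvPolynomial (Fin 2) ℂ) : Set P2 :=
  {x | homLift f x.rep = 0}

/-- The rational extension of `f` to the projective plane, off the indeterminacy set. -/
noncomputable def extension (f : Fin 2 → MvPolynomial (Fin 2) ℂ) (x : P2)
    (hx : x ∉ indeterminacySet f) : P2 :=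
  Projectivization.mk ℂ (homLift f x.rep) (fun h => hx h)

/-- The image `f(L_∞ ∖ I(f))`. -/
def imageOfLineAtInfinity (f : Fin 2 → MvPolynomial (Fin 2) ℂ) : Set P2 :=
  {y | ∃ (x : P2) (hx : x ∉ indeterminacySet f), x ∈ lineAtInfinity ∧ extension f x hx = y}

/-- The line at infinity is attracting: `‖f(p)‖ ≥ c ‖p‖` for `‖p‖` large, for some `c > 1`. -/
def InfinityAttracting (f : Fin 2 → MvPolynomial (Fin 2) ℂ) : Prop :=
  ∃ c : ℝ, 1 < c ∧ ∃ R : ℝ, ∀ p : C2, R ≤ ‖p‖ → c * ‖p‖ ≤ ‖polyMap f p‖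

/-- The number `ℓ x ≥ 1` is a local escape exponent of `f` at each indeterminacy point `x`,
relatively to the neighborhood `V` of the image `X` of the line at infinity. -/
def HasLocalExponents (f : Fin 2 → MvPolynomial (Fin 2) ℂ) (V : Set P2) (ℓ : P2 → ℝ) : Prop :=
  ∀ x ∈ indeterminacySet f, 1 ≤ ℓ x ∧
    ∃ C₁ : ℝ, 0 < C₁ ∧ ∃ C₂ : ℝ, 0 < C₂ ∧ ∃ U ∈ 𝓝 x, ∀ p : C2,
      toP2 p ∈ U → toP2 (polyMap f p) ∉ V →
        C₁ * ‖p‖ ^ ℓ x ≤ ‖polyMap f p‖ ∧ ‖polyMap f p‖ ≤ C₂ * ‖p‖ ^ ℓ x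

/-- The orbit of `p` escapes to infinity. -/
def Escapes (f : Fin 2 → MvPolynomial (Fin 2) ℂ) (p : C2) : Prop :=
  Tendsto (fun n : ℕ => ‖(polyMap f)^[n] p‖) atTop atTop

/-- The sequence `(1/n) log⁺ log⁺ ‖fⁿ(p)‖`. For a polynomial map it is bounded, so that its
real upper and lower limits below are the genuine ones. -/
noncomputable def escapeSeq (f : Fin 2 → MvPolynomial (Fin 2) ℂ) (p : C2) (n : ℕ) : ℝ :=
  (1 / (n : ℝ)) * Real.posLog (Real.posLog ‖(polyMap f)^[n] p‖)

/-- The upper escape rate. -/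
noncomputable def upperEscapeRate (f : Fin 2 → MvPolynomial (Fin 2) ℂ) (p : C2) : ℝ :=
  Real.exp (limsup (escapeSeq f p) atTop)

/-- The lower escape rate. -/
noncomputable def lowerEscapeRate (f : Fin 2 → MvPolynomial (Fin 2) ℂ) (p : C2) : ℝ :=
  Real.exp (liminf (escapeSeq f p) atTop)

/-- The upper and lower escape rates of `p` coincide, and are equal to `r`. -/
def HasEscapeRate (f : Fin 2 → MvPolynomial (Fin 2) ℂ) (p : C2) (r : ℝ) : Prop :=
  lowerEscapeRate f p = r ∧ upperEscapeRate f p = r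

/-- The points of the affine plane whose orbit converges to `X` in the projective plane. -/
def basin (f : Fin 2 → MvPolynomial (Fin 2) ℂ) (X : P2) : Set C2 :=
  {p | Tendsto (fun n : ℕ => toP2 ((polyMap f)^[n] p)) atTop (𝓝 X)}

end EscapeRates

/-! Since `L_∞ \ I(f)` is contracted to `X`, the part of `f` of degree `d` is `h • X₀`, where `X₀`
spans the direction of `X` and `h` is homogeneous of degree `d`. The zero lines of `h` are the
points of `I(f)`, finite in number, and `h X₀ ≠ 0` because `X` is not one of them. Put a thin cone
around each zero line.

Near infinity and outside the cones, `h p` has the full order `‖p‖ ^ d` and dominates the remainder.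
The image is then almost parallel to `X₀`, again outside the cones, and of norm comparable to `‖p‖ ^
d`. An orbit that leaves the cones there thus converges to `X` and has escape rate `d`
(`eventually_escape_outside`). Any other escaping orbit eventually stays in the cones, which lie off
`V` near infinity, so each step raises the norm to the power `ℓ_x` of the current cone, up to
constants. Hence `(1/n) log⁺ log⁺ ‖fⁿ(p)‖` differs by `o(1)` from the mean of the numbers `log ℓ_x`
along the itinerary (`tendsto_posLog_posLog_sub_mean`), and the rate lies in `[a, b]`.

Conversely, every itinerary occurs (`eventually_exists_itinerary`): on a complex line transverse to
the first cone, Rouché's theorem produces parameters that follow longer and longer prefixes, and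
compactness gives a limit. Itineraries in two cones, with exponents `a` and `b` mixed in the right
proportion, realise every rate in `[a, b]`. A constant itinerary gives `b ≤ d - 1`, since a point
whose image lies in a cone has `‖f(p)‖ = O(‖p‖ ^ (d - 1))`. So `d` is not in `[a, b]`; points that
do not escape have bounded orbits and rate `1 < d`. The rate `d` therefore characterises the basin.
-/

namespace EscapeRates

/-! ### Persistence of zeros of entire functions -/

/-- An existence form of Rouché's theorem on a bounded open set. -/
theorem exists_add_eq_zero_of_norm_lt_on_frontier {O : Set ℂ} (hO : IsOpen O)
    (hb : Bornology.IsBounded O) {A B : ℂ → ℂ} (hA : Differentiable ℂ A)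
    (hB : Differentiable ℂ B) (hAB : ∀ z ∈ frontier O, ‖B z‖ < ‖A z‖)
    {z₀ : ℂ} (hz₀ : z₀ ∈ O) (hAz₀ : A z₀ = 0) : ∃ z ∈ O, A z + B z = 0 := by
  have hcl : IsCompact (closure O) := hb.isCompact_closure
  -- A frontier point will exclude that `A + θB` vanishes identically.
  have hfr : (frontier O).Nonempty := by
    rw [Set.nonempty_iff_ne_empty]
    intro h
    rcases isClopen_iff.1 (isClopen_iff_frontier_eq_empty.2 h) with h1 | h1
    · simp [h1] at hz₀
    · rw [h1] at hb
      exact NoncompactSpace.noncompact_univ (by simpa [h1] using hcl)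
  -- Continuity method: the set of `θ` in `[0, 1]` for which `A + θB` has a zero in `closure O`
  -- contains `0`, is closed by compactness, and is open to the right. The frontier inequality keeps
  -- the zeros inside `O`.
  set S : Set ℝ := {θ | ∃ z ∈ closure O, A z + (θ : ℂ) * B z = 0} with hS
  have hmem : ∀ θ ∈ Set.Icc (0 : ℝ) 1, ∀ z ∈ closure O, A z + (θ : ℂ) * B z = 0 → z ∈ O := by
    intro θ hθ z hz h0
    by_contra hzO
    have h1 := hAB z ⟨hz, by rwa [hO.interior_eq]⟩
    have h2 : ‖A z‖ = |θ| * ‖B z‖ := by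
      rw [eq_neg_of_add_eq_zero_left h0, norm_neg, norm_mul, Complex.norm_real, Real.norm_eq_abs]
    rw [abs_of_nonneg hθ.1] at h2
    nlinarith [hθ.2, norm_nonneg (B z)]
  have hclosed : IsClosed (S ∩ Set.Icc 0 1) := by
    have hK : IsCompact ((Set.Icc (0 : ℝ) 1 ×ˢ closure O) ∩
        {q : ℝ × ℂ | A q.2 + (q.1 : ℂ) * B q.2 = 0}) := by
      refine (isCompact_Icc.prod hcl).inter_right (isClosed_eq ?_ continuous_const)
      have := hA.continuous
      have := hB.continuous
      fun_prop
    convert (hK.image continuous_fst).isClosed using 1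
    ext θ
    constructor
    · rintro ⟨⟨z, hz, h0⟩, hθ⟩
      exact ⟨(θ, z), ⟨⟨hθ, hz⟩, h0⟩, rfl⟩
    · rintro ⟨⟨θ', z⟩, ⟨⟨hθ, hz⟩, h0⟩, rfl⟩
      exact ⟨⟨z, hz, h0⟩, hθ⟩
  have hsub : Set.Icc (0 : ℝ) 1 ⊆ S := by
    refine hclosed.Icc_subset_of_forall_mem_nhdsWithin ⟨z₀, subset_closure hz₀, by simp [hAz₀]⟩ ?_
    rintro θ ⟨⟨z, hz, h0⟩, hθ⟩
    refine mem_nhdsWithin_of_mem_nhds ?_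
    have hθ' : θ ∈ Set.Icc (0 : ℝ) 1 := ⟨hθ.1, hθ.2.le⟩
    have hzO := hmem θ hθ' z hz h0
    set G : ℂ → ℂ := fun z => A z + (θ : ℂ) * B z with hG
    have hGd : Differentiable ℂ G := hA.add (hB.const_mul _)
    have hiso : ∀ᶠ w in 𝓝[≠] z, G w ≠ 0 := by
      rcases (hGd.analyticAt z).eventually_eq_zero_or_eventually_ne_zero with h1 | h1
      · exfalso
        have han : AnalyticOnNhd ℂ G Set.univ := fun w _ => hGd.analyticAt w
        have h2 := han.eqOn_zero_of_preconnected_of_eventuallyEq_zero isPreconnected_univ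
          (Set.mem_univ z) h1
        obtain ⟨w, hw⟩ := hfr
        have h3 : w ∈ O := hmem θ hθ' w hw.1 (h2 (Set.mem_univ w))
        exact hw.2 (by rwa [hO.interior_eq])
      · exact h1
    obtain ⟨r₁, hr₁, hball⟩ := Metric.isOpen_iff.1 hO z hzO
    obtain ⟨r₂, hr₂, hne⟩ := Metric.eventually_nhds_iff.1 (eventually_nhdsWithin_iff.1 hiso)
    set r := min r₁ r₂ / 2 with hr
    have hrpos : 0 < r := half_pos (lt_min hr₁ hr₂)
    have hrr₁ : r < r₁ := (half_lt_self (lt_min hr₁ hr₂)).trans_le (min_le_left _ _)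
    have hrr₂ : r < r₂ := (half_lt_self (lt_min hr₁ hr₂)).trans_le (min_le_right _ _)
    have hsph : (Metric.sphere z r).Nonempty := NormedSpace.sphere_nonempty.2 hrpos.le
    obtain ⟨w₀, hw₀, hmin⟩ := (isCompact_sphere z r).exists_isMinOn hsph
      hGd.continuous.norm.continuousOn
    set ε := ‖G w₀‖ with hε
    have hεpos : 0 < ε := by
      refine norm_pos_iff.2 (hne (by rw [Metric.mem_sphere.1 hw₀]; exact hrr₂) ?_)
      rintro rfl
      simp at hw₀
      exact hrpos.ne hw₀
    obtain ⟨M, hM⟩ := (isCompact_closedBall z r).exists_bound_of_continuousOn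
      hB.continuous.continuousOn
    have hM0 : 0 ≤ M := (norm_nonneg _).trans (hM z (Metric.mem_closedBall_self hrpos.le))
    have hev : ∀ᶠ θ' : ℝ in 𝓝 θ, |θ' - θ| * M < ε / 8 := by
      have hc : Continuous fun θ' : ℝ => |θ' - θ| * M := by fun_prop
      exact hc.continuousAt.eventually_lt continuousAt_const (by simpa using hεpos)
    filter_upwards [hev] with θ' hθ''
    set H : ℂ → ℂ := fun z => A z + (θ' : ℂ) * B z with hH
    have hHd : Differentiable ℂ H := hA.add (hB.const_mul _)
    have hHG : ∀ w, H w = G w + ((θ' - θ : ℝ) : ℂ) * B w := by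
      intro w; simp only [hH, hG]; push_cast; ring
    have hsmall : ∀ w ∈ Metric.closedBall z r, ‖((θ' - θ : ℝ) : ℂ) * B w‖ < ε / 8 := by
      intro w hw
      rw [norm_mul, Complex.norm_real, Real.norm_eq_abs]
      exact (mul_le_mul_of_nonneg_left (hM w hw) (abs_nonneg _)).trans_lt hθ''
    have hGz : G z = 0 := h0
    have hHz : ‖H z‖ < ε / 8 := by
      rw [hHG, hGz, zero_add]
      exact hsmall z (Metric.mem_closedBall_self hrpos.le)
    have hsphere : ∀ w ∈ Metric.sphere z r, ε / 2 ≤ ‖H w - H z‖ := by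
      intro w hw
      have h1 : ε ≤ ‖G w‖ := hmin hw
      have h2 := hsmall w (Metric.sphere_subset_closedBall hw)
      have h3 : G w = (H w - H z) + H z - ((θ' - θ : ℝ) : ℂ) * B w := by rw [hHG w]; ring
      have h4 : ‖G w‖ ≤ ‖H w - H z‖ + ‖H z‖ + ‖((θ' - θ : ℝ) : ℂ) * B w‖ := by
        conv_lhs => rw [h3]
        exact (norm_sub_le _ _).trans (by gcongr; exact norm_add_le _ _)
      linarith
    have hfreq : ∃ᶠ w in 𝓝 z, H w ≠ H z := by
      intro hcon
      simp only [not_not] at hcon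
      have han : AnalyticOnNhd ℂ H Set.univ := fun w _ => hHd.analyticAt w
      have h2 := han.eqOn_of_preconnected_of_eventuallyEq (g := fun _ => H z)
        (fun w _ => analyticAt_const) isPreconnected_univ (Set.mem_univ z) hcon
      have h3 := hsphere w₀ hw₀
      rw [h2 (Set.mem_univ w₀)] at h3
      simp at h3
      linarith
    -- Quantitative open mapping theorem: `H` moves by at least `ε / 2` on the circle, so its image
    -- of the disc contains the disc of radius `ε / 4` about `H z`, and `‖H z‖ < ε / 8`.
    have himg := hHd.diffContOnCl.ball_subset_image_closedBall hrpos hsphere hfreq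
    obtain ⟨w, hw, hw0⟩ := himg (show (0 : ℂ) ∈ Metric.ball (H z) (ε / 2 / 2) by
      rw [Metric.mem_ball, dist_zero_left]; linarith)
    exact ⟨w, subset_closure (hball (lt_of_le_of_lt hw hrr₁)), hw0⟩
  obtain ⟨z, hz, h0⟩ := hsub (Set.right_mem_Icc.2 zero_le_one)
  exact ⟨z, hmem 1 (Set.right_mem_Icc.2 zero_le_one) z hz h0, by simpa using h0⟩

/-! ### The determinant as a measure of the angle to a line -/

/-- The determinant of two vectors of the plane. -/
def wedge (v p : C2) : ℂ := v 0 * p 1 - v 1 * p 0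

/-- The orthogonal vector of the same length. -/
noncomputable def perp (v : C2) : C2 := !₂[-(starRingEnd ℂ) (v 1), (starRingEnd ℂ) (v 0)]

theorem wedge_self (v : C2) : wedge v v = 0 := by unfold wedge; ring

theorem wedge_add (v p q : C2) : wedge v (p + q) = wedge v p + wedge v q := by
  simp only [wedge, PiLp.add_apply]; ring

theorem wedge_sub (v p q : C2) : wedge v (p - q) = wedge v p - wedge v q := by
  simp only [wedge, PiLp.sub_apply]; ring

theorem wedge_smul (v p : C2) (t : ℂ) : wedge v (t • p) = t * wedge v p := by
  simp only [wedge, PiLp.smul_apply, smul_eq_mul]; ring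

theorem wedge_comm (v p : C2) : wedge v p = -wedge p v := by unfold wedge; ring

theorem differentiable_wedge (v : C2) : Differentiable ℂ (wedge v) := by
  unfold wedge; fun_prop

theorem continuous_wedge (v : C2) : Continuous (wedge v) := (differentiable_wedge v).continuous

theorem norm_wedge_sq_add (v p : C2) :
    ‖wedge v p‖ ^ 2 + ‖inner ℂ v p‖ ^ 2 = ‖v‖ ^ 2 * ‖p‖ ^ 2 := by
  simp only [wedge, EuclideanSpace.norm_sq_eq, PiLp.inner_apply, Fin.sum_univ_two,
    RCLike.inner_apply]
  simp only [← Complex.normSq_eq_norm_sq]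
  apply Complex.ofReal_injective
  push_cast
  simp only [Complex.normSq_eq_conj_mul_self, map_sub, map_add, map_mul, Complex.conj_conj]
  ring

theorem norm_wedge_le (v p : C2) : ‖wedge v p‖ ≤ ‖v‖ * ‖p‖ := by
  refine le_of_sq_le_sq ?_ (by positivity)
  rw [mul_pow, ← norm_wedge_sq_add]
  nlinarith [sq_nonneg ‖inner ℂ v p‖]

theorem wedge_perp (v : C2) : wedge v (perp v) = ((‖v‖ ^ 2 : ℝ) : ℂ) := by
  simp only [wedge, perp, EuclideanSpace.norm_sq_eq, Fin.sum_univ_two,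
    ← Complex.normSq_eq_norm_sq]
  push_cast
  simp only [Complex.normSq_eq_conj_mul_self]
  simp
  ring

theorem eq_add_perp {v : C2} (hv : v ≠ 0) (p : C2) :
    p = (wedge v p / ((‖v‖ ^ 2 : ℝ) : ℂ)) • perp v +
      (inner ℂ v p / ((‖v‖ ^ 2 : ℝ) : ℂ)) • v := by
  have h0 : ((‖v‖ ^ 2 : ℝ) : ℂ) ≠ 0 := by
    exact_mod_cast pow_ne_zero 2 (norm_ne_zero_iff.2 hv)
  have h1 : ((‖v‖ ^ 2 : ℝ) : ℂ) • p = wedge v p • perp v + inner ℂ v p • v := by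
    rw [EuclideanSpace.norm_sq_eq]
    simp only [Fin.sum_univ_two, ← Complex.normSq_eq_norm_sq]
    push_cast
    simp only [Complex.normSq_eq_conj_mul_self]
    ext i
    fin_cases i <;>
      simp [wedge, perp, PiLp.inner_apply, Fin.sum_univ_two, RCLike.inner_apply] <;> ring
  rw [div_eq_inv_mul, div_eq_inv_mul, mul_smul, mul_smul, ← smul_add, ← h1, inv_smul_smul₀ h0]

theorem eq_smul_of_wedge_eq_zero {v p : C2} (hv : v ≠ 0) (h : wedge v p = 0) :
    ∃ t : ℂ, p = t • v := by
  have h1 := eq_add_perp hv p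
  rw [h, zero_div, zero_smul, zero_add] at h1
  exact ⟨_, h1⟩

theorem norm_add_smul_perp_sq (v : C2) (σ : ℂ) :
    ‖v + σ • perp v‖ ^ 2 = ‖v‖ ^ 2 * (1 + ‖σ‖ ^ 2) := by
  simp only [perp, EuclideanSpace.norm_sq_eq, Fin.sum_univ_two,
    ← Complex.normSq_eq_norm_sq]
  apply Complex.ofReal_injective
  push_cast
  simp only [Complex.normSq_eq_conj_mul_self]
  simp
  ring

/-! ### Maps with a leading form, and their growth near infinity -/

/-- `F` is an entire map of the plane, of the form `h • X₀` up to terms of lower degree, with `h`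
homogeneous of degree `d > 0`, and the line at infinity is attracting. -/
structure LeadingForm (F : C2 → C2) (h : C2 → ℂ) (d : ℕ) (X₀ : C2) : Prop where
  differentiable_map : Differentiable ℂ F
  differentiable_lead : Differentiable ℂ h
  lead_smul : ∀ (t : ℂ) (p : C2), h (t • p) = t ^ d * h p
  lead_ne_zero : h X₀ ≠ 0
  vertex_ne_zero : X₀ ≠ 0
  degree_pos : 0 < d
  remainder : ∃ C : ℝ, 0 < C ∧ ∀ p : C2, 1 ≤ ‖p‖ → ‖F p - h p • X₀‖ ≤ C * ‖p‖ ^ (d - 1)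
  attracting : ∃ c : ℝ, 1 < c ∧ ∃ R : ℝ, ∀ p : C2, R ≤ ‖p‖ → c * ‖p‖ ≤ ‖F p‖

/-- The vectors `v i` span the zero lines of the leading form, and `ρ` is an opening for which the
cones `‖wedge (v i) p‖ ≤ ρ * ‖p‖` are thin. -/
structure ConeSystem (F : C2 → C2) (h : C2 → ℂ) (d : ℕ) (X₀ : C2) {ι : Type*} (v : ι → C2)
    (ρ : ℝ) : Prop extends LeadingForm F h d X₀ where
  axis_ne_zero : ∀ i, v i ≠ 0
  lead_axis : ∀ i, h (v i) = 0
  exists_axis : ∀ p, p ≠ 0 → h p = 0 → ∃ i, wedge (v i) p = 0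
  opening_pos : 0 < ρ
  opening_vertex : ∀ i, 2 * ρ * ‖X₀‖ ≤ ‖wedge (v i) X₀‖
  opening_le : ∀ i, ρ ≤ ‖v i‖ / 2
  lead_ne_zero_of_boundary : ∀ i p, p ≠ 0 → ‖wedge (v i) p‖ = ρ * ‖p‖ → h p ≠ 0

namespace LeadingForm

variable {F : C2 → C2} {h : C2 → ℂ} {d : ℕ} {X₀ : C2}

theorem wedge_vertex_ne_zero (H : LeadingForm F h d X₀) {u : C2} (hu : u ≠ 0) (hh : h u = 0) :
    wedge u X₀ ≠ 0 := by
  intro h0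
  obtain ⟨t, ht⟩ := eq_smul_of_wedge_eq_zero hu h0
  apply H.lead_ne_zero
  rw [ht, H.lead_smul, hh, mul_zero]

/-- Finitely many conditions, each valid for small `ρ`. A zero of `h` on the boundary of the cone
about `v i` would be a multiple of some `v j`. This is impossible for `j = i`, where the determinant
vanishes, and for `j ≠ i` once `ρ` is less than `‖wedge (v i) (v j)‖ / ‖v j‖`. -/
theorem eventually_coneSystem (H : LeadingForm F h d X₀) {ι : Type*} [Finite ι] {v : ι → C2}
    (hv : ∀ i, v i ≠ 0) (hroot : ∀ i, h (v i) = 0)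
    (hzero : ∀ p, p ≠ 0 → h p = 0 → ∃ i, wedge (v i) p = 0)
    (hdist : ∀ i j, i ≠ j → wedge (v i) (v j) ≠ 0) :
    ∀ᶠ ρ in 𝓝[>] (0 : ℝ), ConeSystem F h d X₀ v ρ := by
  have small : ∀ c : ℝ, 0 < c → ∀ᶠ ρ in 𝓝[>] (0 : ℝ), ρ < c := fun c hc =>
    mem_nhdsWithin_of_mem_nhds (Iio_mem_nhds hc)
  have hX : 0 < ‖X₀‖ := norm_pos_iff.2 H.vertex_ne_zero
  have hv' : ∀ i, 0 < ‖v i‖ := fun i => norm_pos_iff.2 (hv i)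
  have h1 : ∀ᶠ ρ in 𝓝[>] (0 : ℝ), ∀ i, ρ < ‖wedge (v i) X₀‖ / (2 * ‖X₀‖) :=
    eventually_all.2 fun i => small _ (div_pos
      (norm_pos_iff.2 (H.wedge_vertex_ne_zero (hv i) (hroot i))) (by positivity))
  have h2 : ∀ᶠ ρ in 𝓝[>] (0 : ℝ), ∀ i, ρ < ‖v i‖ / 2 :=
    eventually_all.2 fun i => small _ (half_pos (hv' i))
  have h3 : ∀ᶠ ρ in 𝓝[>] (0 : ℝ), ∀ i j, i ≠ j → ρ < ‖wedge (v i) (v j)‖ / ‖v j‖ := by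
    refine eventually_all.2 fun i => eventually_all.2 fun j => ?_
    by_cases hij : i = j
    · simp [hij]
    · filter_upwards [small _ (div_pos (norm_pos_iff.2 (hdist i j hij)) (hv' j))] with ρ hρ _
      exact hρ
  filter_upwards [h1, h2, h3, self_mem_nhdsWithin] with ρ h1 h2 h3 hρ
  refine { H with
    axis_ne_zero := hv, lead_axis := hroot, exists_axis := hzero, opening_pos := hρ
    opening_vertex := fun i => ?_, opening_le := fun i => (h2 i).le
    lead_ne_zero_of_boundary := fun i p hp hb h0 => ?_ }
  · have := (lt_div_iff₀ (by positivity)).1 (h1 i)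
    linarith
  · obtain ⟨j, hj⟩ := hzero p hp h0
    obtain ⟨t, rfl⟩ := eq_smul_of_wedge_eq_zero (hv j) hj
    have ht : 0 < ‖t‖ := norm_pos_iff.2 (by rintro rfl; simp at hp)
    have hρ' : (0 : ℝ) < ρ := hρ
    rw [wedge_smul, norm_mul, norm_smul] at hb
    have hb' : ‖wedge (v i) (v j)‖ = ρ * ‖v j‖ := by
      apply mul_left_cancel₀ ht.ne'
      linarith
    by_cases hij : i = j
    · subst hij
      rw [wedge_self, norm_zero] at hb'
      exact (mul_pos hρ' (hv' i)).ne hb'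
    · have := (lt_div_iff₀ (hv' j)).1 (h3 i j hij)
      linarith

/-- A bound for the values of a homogeneous function from its values on the unit sphere. -/
theorem norm_lead_eq (H : LeadingForm F h d X₀) {p : C2} (hp : p ≠ 0) :
    ‖h p‖ = ‖p‖ ^ d * ‖h (((‖p‖⁻¹ : ℝ) : ℂ) • p)‖ := by
  have : ‖p‖ ≠ 0 := norm_ne_zero_iff.2 hp
  rw [H.lead_smul, norm_mul, norm_pow, Complex.norm_real, norm_inv, norm_norm,
    inv_pow, mul_inv_cancel_left₀ (pow_ne_zero _ this)]

theorem norm_normalize {p : C2} (hp : p ≠ 0) : ‖((‖p‖⁻¹ : ℝ) : ℂ) • p‖ = 1 := by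
  rw [norm_smul, Complex.norm_real, norm_inv, norm_norm, inv_mul_cancel₀ (norm_ne_zero_iff.2 hp)]

theorem exists_norm_map_le (H : LeadingForm F h d X₀) :
    ∃ C : ℝ, 0 < C ∧ ∀ p : C2, 1 ≤ ‖p‖ → ‖F p‖ ≤ C * ‖p‖ ^ d := by
  obtain ⟨M, hM⟩ := (isCompact_sphere (0 : C2) 1).exists_bound_of_continuousOn
    H.differentiable_lead.continuous.continuousOn
  obtain ⟨C, hC, hrem⟩ := H.remainder
  refine ⟨|M| * ‖X₀‖ + C, by positivity, fun p hp => ?_⟩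
  have hp0 : p ≠ 0 := by rintro rfl; simp at hp; linarith
  have h1 : ‖h p‖ ≤ ‖p‖ ^ d * |M| := by
    rw [H.norm_lead_eq hp0]
    gcongr
    exact (hM _ (by simpa using norm_normalize hp0)).trans (le_abs_self M)
  have h2 := hrem p hp
  have h3 : ‖p‖ ^ (d - 1) ≤ ‖p‖ ^ d := pow_le_pow_right₀ hp (Nat.sub_le d 1)
  calc ‖F p‖ = ‖h p • X₀ + (F p - h p • X₀)‖ := by rw [add_sub_cancel]
    _ ≤ ‖h p‖ * ‖X₀‖ + C * ‖p‖ ^ d :=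
      (norm_add_le _ _).trans (add_le_add (norm_smul _ _).le (h2.trans (by gcongr)))
    _ ≤ (‖p‖ ^ d * |M|) * ‖X₀‖ + C * ‖p‖ ^ d := by gcongr
    _ = (|M| * ‖X₀‖ + C) * ‖p‖ ^ d := by ring

/-- Where `h` has its full order `‖p‖ ^ d`, a remainder of order `‖p‖ ^ (d - 1)` is negligible. -/
theorem eventually_remainder_le (H : LeadingForm F h d X₀) {c : ℝ} (hc : 0 < c) {η : ℝ}
    (hη : 0 < η) : ∀ᶠ R in atTop, ∀ p : C2, R ≤ ‖p‖ → c * ‖p‖ ^ d ≤ ‖h p‖ →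
      ‖F p - h p • X₀‖ ≤ η * ‖h p‖ := by
  obtain ⟨C, hC, hrem⟩ := H.remainder
  filter_upwards [eventually_ge_atTop 1, eventually_ge_atTop (C / (c * η))] with R h1 h2 p hp hcp
  have hp1 : 1 ≤ ‖p‖ := h1.trans hp
  have h3 : C ≤ ‖p‖ * (c * η) := (div_le_iff₀ (by positivity)).1 (h2.trans hp)
  have h4 : ‖p‖ ^ d = ‖p‖ ^ (d - 1) * ‖p‖ := by
    rw [← pow_succ, Nat.sub_add_cancel H.degree_pos]
  calc ‖F p - h p • X₀‖ ≤ C * ‖p‖ ^ (d - 1) := hrem p hp1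
    _ ≤ ‖p‖ * (c * η) * ‖p‖ ^ (d - 1) := by gcongr
    _ = η * (c * ‖p‖ ^ d) := by rw [h4]; ring
    _ ≤ η * ‖h p‖ := by gcongr

theorem eventually_norm_map_ge (H : LeadingForm F h d X₀) {c : ℝ} (hc : 0 < c) :
    ∀ᶠ R in atTop, ∀ p : C2, R ≤ ‖p‖ → c * ‖p‖ ^ d ≤ ‖h p‖ →
      c * ‖X₀‖ / 2 * ‖p‖ ^ d ≤ ‖F p‖ ∧ ‖h p‖ * ‖X₀‖ ≤ 2 * ‖F p‖ := by
  have hX : 0 < ‖X₀‖ := norm_pos_iff.2 H.vertex_ne_zero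
  filter_upwards [H.eventually_remainder_le hc (half_pos hX)] with R hR p hp hcp
  have h1 := hR p hp hcp
  have h2 : ‖h p • X₀‖ ≤ ‖F p‖ + ‖F p - h p • X₀‖ := by
    conv_lhs => rw [← sub_sub_cancel (F p) (h p • X₀)]
    exact norm_sub_le _ _
  rw [norm_smul] at h2
  have h3 : ‖h p‖ * ‖X₀‖ ≤ 2 * ‖F p‖ := by linarith
  refine ⟨?_, h3⟩
  nlinarith

theorem eventually_wedge_vertex_le (H : LeadingForm F h d X₀) {c : ℝ} (hc : 0 < c) {η : ℝ}
    (hη : 0 < η) : ∀ᶠ R in atTop, ∀ p : C2, R ≤ ‖p‖ → c * ‖p‖ ^ d ≤ ‖h p‖ →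
      ‖wedge X₀ (F p)‖ ≤ η * ‖F p‖ := by
  filter_upwards [H.eventually_remainder_le hc (half_pos hη), H.eventually_norm_map_ge hc]
    with R hR hR' p hp hcp
  have h1 : wedge X₀ (F p) = wedge X₀ (F p - h p • X₀) := by
    rw [wedge_sub, wedge_smul, wedge_self, mul_zero, sub_zero]
  calc ‖wedge X₀ (F p)‖ ≤ ‖X₀‖ * ‖F p - h p • X₀‖ := by rw [h1]; exact norm_wedge_le _ _
    _ ≤ ‖X₀‖ * (η / 2 * ‖h p‖) := by gcongr; exact hR p hp hcp
    _ = η / 2 * (‖h p‖ * ‖X₀‖) := by ring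
    _ ≤ η / 2 * (2 * ‖F p‖) := mul_le_mul_of_nonneg_left (hR' p hp hcp).2 (by positivity)
    _ = η * ‖F p‖ := by ring

theorem eventually_norm_iterate_ge (H : LeadingForm F h d X₀) :
    ∀ᶠ R in atTop, ∀ p : C2, R ≤ ‖p‖ → ∀ n, ‖p‖ ≤ ‖F^[n] p‖ := by
  obtain ⟨c, hc, R₀, hR₀⟩ := H.attracting
  filter_upwards [eventually_ge_atTop R₀] with R hR p hp n
  induction n with
  | zero => exact le_rfl
  | succ n ih =>
    rw [Function.iterate_succ_apply']
    have := hR₀ _ (hR.trans (hp.trans ih))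
    nlinarith [norm_nonneg (F^[n] p)]

theorem eventually_tendsto_norm_iterate (H : LeadingForm F h d X₀) :
    ∀ᶠ R in atTop, ∀ p : C2, R ≤ ‖p‖ → Tendsto (fun n => ‖F^[n] p‖) atTop atTop := by
  obtain ⟨c, hc, R₀, hR₀⟩ := H.attracting
  filter_upwards [eventually_ge_atTop R₀, eventually_ge_atTop 1, H.eventually_norm_iterate_ge]
    with R hR hR1 hmono p hp
  have h1 : ∀ n, c ^ n * ‖p‖ ≤ ‖F^[n] p‖ := by
    intro n
    induction n with
    | zero => simp
    | succ n ih =>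
      rw [Function.iterate_succ_apply']
      have := hR₀ _ (hR.trans (hp.trans (hmono p hp n)))
      calc c ^ (n + 1) * ‖p‖ = c * (c ^ n * ‖p‖) := by ring
        _ ≤ c * ‖F^[n] p‖ := by gcongr
        _ ≤ _ := this
  exact tendsto_atTop_mono h1
    ((tendsto_pow_atTop_atTop_of_one_lt hc).atTop_mul_const (by linarith))

end LeadingForm

/-! ### Cones about the zero lines, and their itineraries -/

namespace ConeSystem

variable {F : C2 → C2} {h : C2 → ℂ} {d : ℕ} {X₀ : C2} {ι : Type*} {v : ι → C2} {ρ : ℝ}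

/-- By homogeneity and compactness of the unit sphere, it suffices that `h` has no zero on the
closed set in question. The boundary of each cone is included separately, so that the cones need not
be disjoint. -/
theorem exists_lead_ge [Finite ι] (H : ConeSystem F h d X₀ v ρ) :
    ∃ c : ℝ, 0 < c ∧ ∀ p : C2, p ≠ 0 →
      ((∀ i, ρ * ‖p‖ ≤ ‖wedge (v i) p‖) ∨ ∃ i, ‖wedge (v i) p‖ = ρ * ‖p‖) →
      c * ‖p‖ ^ d ≤ ‖h p‖ := by
  set T : Set C2 := {p | (∀ i, ρ * ‖p‖ ≤ ‖wedge (v i) p‖) ∨ ∃ i, ‖wedge (v i) p‖ = ρ * ‖p‖}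
    with hT
  have hTc : IsClosed T := by
    have h1 : T = (⋂ i, {p | ρ * ‖p‖ ≤ ‖wedge (v i) p‖}) ∪
        ⋃ i, {p | ‖wedge (v i) p‖ = ρ * ‖p‖} := by
      ext p; simp [hT]
    rw [h1]
    refine IsClosed.union (isClosed_iInter fun i => ?_) (isClosed_iUnion_of_finite fun i => ?_)
    · exact isClosed_le (by fun_prop) (continuous_wedge _).norm
    · exact isClosed_eq (continuous_wedge _).norm (by fun_prop)
  have hK : IsCompact (Metric.sphere (0 : C2) 1 ∩ T) := (isCompact_sphere _ _).inter_right hTc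
  obtain ⟨c, hc, hcle⟩ := hK.exists_forall_le' (f := fun p => ‖h p‖) (a := 0)
    H.differentiable_lead.continuous.norm.continuousOn (by
      rintro p ⟨hp, hpT⟩
      have hp0 : p ≠ 0 := by rintro rfl; simp at hp
      refine norm_pos_iff.2 fun h0 => ?_
      rcases hpT with h1 | ⟨i, hi⟩
      · obtain ⟨i, hi⟩ := H.exists_axis p hp0 h0
        have := h1 i
        rw [hi, norm_zero] at this
        have := mul_pos H.opening_pos (norm_pos_iff.2 hp0)
        linarith
      · exact H.lead_ne_zero_of_boundary i p hp0 hi h0)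
  refine ⟨c, hc, fun p hp hpT => ?_⟩
  rw [H.norm_lead_eq hp, mul_comm]
  gcongr
  refine hcle _ ⟨by simpa using LeadingForm.norm_normalize hp, ?_⟩
  have hpos : 0 < ‖p‖⁻¹ := inv_pos.2 (norm_pos_iff.2 hp)
  have hn : ‖((‖p‖⁻¹ : ℝ) : ℂ)‖ = ‖p‖⁻¹ := by
    rw [Complex.norm_real, norm_inv, norm_norm]
  refine hpT.imp (fun h1 i => ?_) (fun ⟨i, hi⟩ => ⟨i, ?_⟩)
  · rw [wedge_smul, norm_mul, norm_smul, hn]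
    nlinarith [h1 i]
  · rw [wedge_smul, norm_mul, norm_smul, hn, hi]
    ring

/-- Here `F p` is `h p • X₀` up to a relatively small error, and `X₀` lies well outside every cone.
The first inequality is the one used on the frontier in Rouché's theorem; the second says that the
image avoids all cones. -/
theorem eventually_outside [Finite ι] (H : ConeSystem F h d X₀ v ρ) {c : ℝ} (hc : 0 < c) :
    ∀ᶠ R in atTop, ∀ p : C2, R ≤ ‖p‖ → c * ‖p‖ ^ d ≤ ‖h p‖ → ∀ j,
      ‖wedge (v j) (F p - h p • X₀)‖ < ‖h p * wedge (v j) X₀‖ ∧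
      ρ * ‖F p‖ < ‖wedge (v j) (F p)‖ := by
  have hρ := H.opening_pos
  have hwX : ∀ j, 0 < ‖wedge (v j) X₀‖ := fun j =>
    norm_pos_iff.2 (H.wedge_vertex_ne_zero (H.axis_ne_zero j) (H.lead_axis j))
  -- The factor 2 in `opening_vertex` leaves half of `‖wedge (v j) X₀‖` to absorb the two errors `ρ
  -- * η` and `‖v j‖ * η`.
  have hη : ∀ᶠ η in 𝓝[>] (0 : ℝ), ∀ j, (ρ + ‖v j‖) * η < ‖wedge (v j) X₀‖ / 2 := by
    refine eventually_all.2 fun j => mem_nhdsWithin_of_mem_nhds ?_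
    have hcont : Continuous fun η : ℝ => (ρ + ‖v j‖) * η := by fun_prop
    exact hcont.continuousAt.eventually_lt continuousAt_const (by simpa using hwX j)
  obtain ⟨η, hη, hη0⟩ := (hη.and self_mem_nhdsWithin).exists
  have hη0 : 0 < η := hη0
  filter_upwards [H.eventually_remainder_le hc hη0, eventually_ge_atTop 1]
    with R hR hR1 p hp hcp j
  have h1 := hR p hp hcp
  have hp0 : 0 < ‖p‖ := by linarith
  have hh : 0 < ‖h p‖ := lt_of_lt_of_le (by positivity) hcp
  have h2 : ‖wedge (v j) (F p - h p • X₀)‖ ≤ ‖v j‖ * (η * ‖h p‖) :=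
    (norm_wedge_le _ _).trans (by gcongr)
  have h3 : ((ρ + ‖v j‖) * η) * ‖h p‖ < ‖wedge (v j) X₀‖ / 2 * ‖h p‖ := by
    gcongr; exact hη j
  have h4 : 0 < ρ * η * ‖h p‖ := by positivity
  have h5 : wedge (v j) (F p) = h p * wedge (v j) X₀ + wedge (v j) (F p - h p • X₀) := by
    rw [wedge_sub, wedge_smul]; ring
  have h6 : ‖F p‖ ≤ ‖h p‖ * ‖X₀‖ + η * ‖h p‖ := by
    calc ‖F p‖ = ‖h p • X₀ + (F p - h p • X₀)‖ := by rw [add_sub_cancel]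
      _ ≤ _ := (norm_add_le _ _).trans (add_le_add (norm_smul _ _).le h1)
  have h7 := mul_le_mul_of_nonneg_left (H.opening_vertex j) hh.le
  have h8 : ‖h p * wedge (v j) X₀‖ ≤
      ‖wedge (v j) (F p)‖ + ‖wedge (v j) (F p - h p • X₀)‖ := by
    rw [h5]
    conv_lhs => rw [← add_sub_cancel_right (h p * wedge (v j) X₀) (wedge (v j) (F p - h p • X₀))]
    exact norm_sub_le _ _
  have h9 : ρ * ‖F p‖ ≤ ρ * (‖h p‖ * ‖X₀‖ + η * ‖h p‖) := by gcongr
  rw [norm_mul] at h8 ⊢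
  have h10 := mul_pos hh (hwX j)
  constructor <;> nlinarith

/-- Source of the bound `b ≤ d - 1`. As `X₀` is outside the cone, `F p` can lie in it only if the
remainder offsets `h p • X₀`; so `h p`, and then `F p`, is of the order of the remainder. -/
theorem exists_norm_map_le_of_mem_cone (H : ConeSystem F h d X₀ v ρ) (j : ι) :
    ∃ C : ℝ, 0 < C ∧ ∀ p : C2, 1 ≤ ‖p‖ → ‖wedge (v j) (F p)‖ ≤ ρ * ‖F p‖ →
      ‖F p‖ ≤ C * ‖p‖ ^ (d - 1) := by
  have hρ := H.opening_pos
  have hw : 0 < ‖wedge (v j) X₀‖ :=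
    norm_pos_iff.2 (H.wedge_vertex_ne_zero (H.axis_ne_zero j) (H.lead_axis j))
  obtain ⟨C, hC, hrem⟩ := H.remainder
  set K := 2 * (ρ + ‖v j‖) / ‖wedge (v j) X₀‖ with hK
  have hK0 : 0 ≤ K := by positivity
  refine ⟨(K * ‖X₀‖ + 1) * C, by positivity, fun p hp hcone => ?_⟩
  have h1 := hrem p hp
  set g := F p - h p • X₀ with hg
  have h5 : h p * wedge (v j) X₀ = wedge (v j) (F p) - wedge (v j) g := by
    rw [hg, wedge_sub, wedge_smul]; ring
  have h6 : ‖F p‖ ≤ ‖h p‖ * ‖X₀‖ + ‖g‖ := by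
    calc ‖F p‖ = ‖h p • X₀ + g‖ := by rw [hg, add_sub_cancel]
      _ ≤ _ := (norm_add_le _ _).trans (add_le_add (norm_smul _ _).le le_rfl)
  have h7 : ‖h p‖ * ‖wedge (v j) X₀‖ ≤ ρ * ‖F p‖ + ‖v j‖ * ‖g‖ := by
    rw [← norm_mul, h5]
    exact (norm_sub_le _ _).trans (add_le_add hcone (norm_wedge_le _ _))
  have h8 := mul_le_mul_of_nonneg_left (H.opening_vertex j) (norm_nonneg (h p))
  have h9 : ρ * ‖F p‖ ≤ ρ * (‖h p‖ * ‖X₀‖ + ‖g‖) := by gcongr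
  have h10 : ‖h p‖ ≤ K * ‖g‖ := by
    rw [hK, div_mul_eq_mul_div, le_div_iff₀ hw]
    nlinarith
  calc ‖F p‖ ≤ ‖h p‖ * ‖X₀‖ + ‖g‖ := h6
    _ ≤ K * ‖g‖ * ‖X₀‖ + ‖g‖ := by gcongr
    _ = (K * ‖X₀‖ + 1) * ‖g‖ := by ring
    _ ≤ (K * ‖X₀‖ + 1) * (C * ‖p‖ ^ (d - 1)) := by gcongr
    _ = _ := by ring

/-- Every itinerary through the cones is realised by points of arbitrarily large norm. -/
theorem eventually_exists_itinerary [Finite ι] (H : ConeSystem F h d X₀ v ρ) :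
    ∀ᶠ R in atTop, ∀ i : ℕ → ι, ∃ p : C2, R ≤ ‖p‖ ∧
      ∀ n, ‖wedge (v (i n)) (F^[n] p)‖ ≤ ρ * ‖F^[n] p‖ := by
  obtain ⟨c, hc, hlead⟩ := H.exists_lead_ge
  filter_upwards [H.eventually_outside hc, H.eventually_norm_iterate_ge, eventually_ge_atTop 1]
    with R hout hmono hR1 i
  have hρ := H.opening_pos
  set u := v (i 0) with hu
  have hupos : 0 < ‖u‖ := norm_pos_iff.2 (H.axis_ne_zero _)
  set T : ℝ := R / ‖u‖ with hT
  have hTpos : 0 < T := by positivity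
  -- The parameter `σ` runs over the complex line orthogonal to `u` through the point `T • u` of
  -- norm `R`, so the whole line stays at norm at least `R`. `P n` is the `n`-th iterate along it.
  set P : ℕ → ℂ → C2 := fun n σ => F^[n] ((T : ℂ) • (u + σ • perp u)) with hP
  have hPsucc : ∀ n σ, P (n + 1) σ = F (P n σ) := fun n σ => Function.iterate_succ_apply' _ _ _
  have hPd : ∀ n, Differentiable ℂ (P n) := by
    intro n
    induction n with
    | zero => simp only [hP, Function.iterate_zero, id]; fun_prop
    | succ n ih =>
      have : P (n + 1) = F ∘ P n := funext (hPsucc n)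
      rw [this]
      exact H.differentiable_map.comp ih
  have hPc : ∀ n, Continuous (P n) := fun n => (hPd n).continuous
  have hbase : ∀ σ : ℂ, ‖(T : ℂ) • (u + σ • perp u)‖ = T * ‖u + σ • perp u‖ := by
    intro σ
    rw [norm_smul, Complex.norm_real, Real.norm_eq_abs, abs_of_pos hTpos]
  have hP0 : ∀ σ : ℂ, R ≤ ‖(T : ℂ) • (u + σ • perp u)‖ := by
    intro σ
    rw [hbase]
    have h1 : ‖u‖ ≤ ‖u + σ • perp u‖ := by
      refine le_of_sq_le_sq ?_ (norm_nonneg _)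
      rw [norm_add_smul_perp_sq]
      nlinarith [mul_nonneg (sq_nonneg ‖u‖) (sq_nonneg ‖σ‖)]
    calc R = T * ‖u‖ := by rw [hT]; field_simp
      _ ≤ _ := by gcongr
  have hPR : ∀ n σ, R ≤ ‖P n σ‖ := fun n σ => (hP0 σ).trans (hmono _ (hP0 σ) n)
  have hPpos : ∀ n σ, 0 < ‖P n σ‖ := fun n σ => by linarith [hPR n σ]
  have hPne : ∀ n σ, P n σ ≠ 0 := fun n σ => norm_pos_iff.1 (hPpos n σ)
  set K : ℕ → Set ℂ := fun N =>
    ⋂ k ∈ Finset.range (N + 1), {σ | ‖wedge (v (i k)) (P k σ)‖ ≤ ρ * ‖P k σ‖} with hKdef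
  set O : ℕ → Set ℂ := fun N =>
    ⋂ k ∈ Finset.range (N + 1), {σ | ‖wedge (v (i k)) (P k σ)‖ < ρ * ‖P k σ‖} with hOdef
  have memK : ∀ {N σ}, σ ∈ K N ↔ ∀ k < N + 1, ‖wedge (v (i k)) (P k σ)‖ ≤ ρ * ‖P k σ‖ := by
    intro N σ; simp [hKdef]
  have memO : ∀ {N σ}, σ ∈ O N ↔ ∀ k < N + 1, ‖wedge (v (i k)) (P k σ)‖ < ρ * ‖P k σ‖ := by
    intro N σ; simp [hOdef]
  have hwc : ∀ k, Continuous fun σ => ‖wedge (v (i k)) (P k σ)‖ := fun k =>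
    ((continuous_wedge _).comp (hPc k)).norm
  have hnc : ∀ k, Continuous fun σ => ρ * ‖P k σ‖ := fun k => continuous_const.mul (hPc k).norm
  have hKc : ∀ N, IsClosed (K N) := fun N =>
    isClosed_biInter fun k _ => isClosed_le (hwc k) (hnc k)
  have hOo : ∀ N, IsOpen (O N) := fun N =>
    isOpen_biInter_finset fun k _ => isOpen_lt (hwc k) (hnc k)
  have hOK : ∀ N, O N ⊆ K N := fun N σ hσ => memK.2 fun k hk => (memO.1 hσ k hk).le
  have hclOK : ∀ N, closure (O N) ⊆ K N := fun N => closure_minimal (hOK N) (hKc N)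
  -- The first cone cuts the line in a bounded set: `ρ ≤ ‖u‖ / 2` gives `‖σ‖ ≤ (1 + ‖σ‖) / 2`.
  have hKball : ∀ N, K N ⊆ Metric.closedBall 0 1 := by
    intro N σ hσ
    have h1 := memK.1 hσ 0 (Nat.succ_pos N)
    have h2 : ‖wedge (v (i 0)) (P 0 σ)‖ = T * (‖σ‖ * ‖u‖ ^ 2) := by
      simp only [hP, Function.iterate_zero, id, ← hu]
      rw [wedge_smul, wedge_add, wedge_self, zero_add, wedge_smul, wedge_perp, norm_mul, norm_mul,
        Complex.norm_real, Complex.norm_real, Real.norm_eq_abs, abs_of_pos hTpos, norm_pow,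
        norm_norm]
    have h3 : ‖P 0 σ‖ = T * ‖u + σ • perp u‖ := hbase σ
    rw [h2, h3] at h1
    have h4 : ‖σ‖ * ‖u‖ ^ 2 ≤ ρ * ‖u + σ • perp u‖ := by
      refine le_of_mul_le_mul_left ?_ hTpos
      linarith
    have h5 : ‖u + σ • perp u‖ ≤ ‖u‖ * (1 + ‖σ‖) := by
      refine le_of_sq_le_sq ?_ (by positivity)
      rw [norm_add_smul_perp_sq, mul_pow]
      gcongr
      nlinarith [norm_nonneg σ]
    have h6 : ‖σ‖ * ‖u‖ ^ 2 ≤ ‖u‖ / 2 * (‖u‖ * (1 + ‖σ‖)) :=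
      h4.trans (mul_le_mul (H.opening_le _) h5 (norm_nonneg _) (by positivity))
    rw [mem_closedBall_zero_iff]
    have h7 : 0 < ‖u‖ ^ 2 := by positivity
    nlinarith
  have hOb : ∀ N, Bornology.IsBounded (O N) := fun N =>
    Metric.isBounded_closedBall.subset ((hOK N).trans (hKball N))
  -- The induction needs more than a nonempty `O N`: the `N`-th iterate has to meet the axis of its
  -- cone, where `h` vanishes, to supply the initial zero for Rouché's theorem at the next stage.
  have key : ∀ N, ∃ σ ∈ O N, wedge (v (i N)) (P N σ) = 0 := by
    intro N
    induction N with
    | zero =>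
      have h0 : wedge (v (i 0)) (P 0 0) = 0 := by
        simp only [hP, Function.iterate_zero, id, ← hu, zero_smul, add_zero]
        rw [wedge_smul, wedge_self, mul_zero]
      refine ⟨0, memO.2 fun k hk => ?_, h0⟩
      obtain rfl : k = 0 := by omega
      rw [h0, norm_zero]
      exact mul_pos hρ (hPpos _ _)
    | succ N ih =>
      obtain ⟨σ₀, hσ₀, hz⟩ := ih
      have hA0 : h (P N σ₀) = 0 := by
        obtain ⟨t, ht⟩ := eq_smul_of_wedge_eq_zero (H.axis_ne_zero _) hz
        rw [ht, H.lead_smul, H.lead_axis, mul_zero]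
      set w := v (i (N + 1)) with hw
      have hA : Differentiable ℂ fun σ => h (P N σ) := H.differentiable_lead.comp (hPd N)
      have hFP : Differentiable ℂ fun σ => F (P N σ) := H.differentiable_map.comp (hPd N)
      have hB : Differentiable ℂ fun σ => F (P N σ) - h (P N σ) • X₀ :=
        hFP.sub (hA.smul_const X₀)
      -- The sum `A + B` is `wedge w (F (P N σ))`, so a zero puts the next iterate on the axis
      -- spanned by `w`.
      obtain ⟨σ, hσ, hσ0⟩ := exists_add_eq_zero_of_norm_lt_on_frontier (hOo N) (hOb N)
        (A := fun σ : ℂ => h (P N σ) * wedge w X₀)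
        (B := fun σ : ℂ => wedge w (F (P N σ) - h (P N σ) • X₀))
        (hA.mul_const _) ((differentiable_wedge w).comp hB)
        (by
          intro σ hσ
          have hσK := memK.1 (hclOK N hσ.1)
          have hσO : σ ∉ O N := by simpa [(hOo N).interior_eq] using hσ.2
          rw [memO] at hσO
          push Not at hσO
          obtain ⟨k, hk, hk'⟩ := hσO
          have heq := le_antisymm (hσK k hk) hk'
          have hl := hlead _ (hPne k σ) (Or.inr ⟨i k, heq⟩)
          have ho := hout _ (hPR k σ) hl
          -- On the frontier some iterate `k` is on the boundary of its cone, so its image is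
          -- outside all cones. If `k < N`, this contradicts the constraint at time `k + 1`; hence
          -- `k = N`, and the inequality between `A` and `B` holds.
          rcases Nat.lt_succ_iff_lt_or_eq.1 hk with hkN | rfl
          · exfalso
            have h1 := hσK (k + 1) (by omega)
            have h2 := (ho (i (k + 1))).2
            rw [← hPsucc] at h2
            linarith
          · exact (ho (i (k + 1))).1)
        hσ₀ (by simp [hA0])
      have h0 : wedge w (P (N + 1) σ) = 0 := by
        rw [hPsucc, ← hσ0, wedge_sub, wedge_smul]; ring
      refine ⟨σ, memO.2 fun k hk => ?_, h0⟩
      rcases Nat.lt_succ_iff_lt_or_eq.1 hk with hkN | rfl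
      · exact memO.1 hσ k hkN
      · rw [h0, norm_zero]
        exact mul_pos hρ (hPpos _ _)
  have hanti : ∀ N, K (N + 1) ⊆ K N := fun N σ hσ => memK.2 fun k hk => memK.1 hσ k (by omega)
  obtain ⟨σ, hσ⟩ := IsCompact.nonempty_iInter_of_sequence_nonempty_isCompact_isClosed K hanti
    (fun N => let ⟨σ, hσ, _⟩ := key N; ⟨σ, hOK N hσ⟩)
    ((isCompact_closedBall _ _).of_isClosed_subset (hKc 0) (hKball 0)) hKc
  exact ⟨_, hP0 σ, fun n => memK.1 (Set.mem_iInter.1 hσ n) n (Nat.lt_succ_self n)⟩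

end ConeSystem

/-! ### Growth rates as means of logarithms -/

/-- If `N (n + 1)` is comparable to `N n ^ e n` and `N` tends to infinity, then the rate of growth
of `log⁺ log⁺ N n` is the mean of the `log (e n)`. -/
theorem tendsto_posLog_posLog_sub_mean {N e : ℕ → ℝ} {C₁ C₂ : ℝ} (hN : Tendsto N atTop atTop)
    (he : ∀ n, 1 ≤ e n) (hC₁ : 0 < C₁) (hC₂ : 0 < C₂)
    (h : ∀ᶠ n in atTop, C₁ * N n ^ e n ≤ N (n + 1) ∧ N (n + 1) ≤ C₂ * N n ^ e n) :
    Tendsto (fun n : ℕ => (1 / (n : ℝ)) * Real.posLog (Real.posLog (N n)) -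
      (1 / (n : ℝ)) * ∑ k ∈ Finset.range n, Real.log (e k)) atTop (𝓝 0) := by
  set z : ℕ → ℝ := fun n => Real.posLog (Real.posLog (N n)) with hz
  set y : ℕ → ℝ := fun n => Real.log (N n) with hy
  have hy_top : Tendsto y atTop atTop := Real.tendsto_log_atTop.comp hN
  have hzy : ∀ᶠ n in atTop, z n = Real.log (y n) := by
    filter_upwards [hy_top.eventually_ge_atTop 1, hN.eventually_ge_atTop 1] with n h1 h2
    have h3 : Real.posLog (N n) = y n := Real.posLog_eq_log (by rwa [abs_of_nonneg (by linarith)])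
    simp only [hz]
    rw [h3]
    exact Real.posLog_eq_log (by rwa [abs_of_nonneg (by linarith)])
  set K := max |Real.log C₁| |Real.log C₂| with hK
  -- Taking logarithms, `y (n + 1) = e n * y n + O(1)`. Dividing by `e n * y n ≥ y n` gives a ratio
  -- tending to 1, without an upper bound on `e n`; a second logarithm and Cesàro means finish.
  have hstep : ∀ᶠ n in atTop, |y (n + 1) / (e n * y n) - 1| ≤ K / y n := by
    filter_upwards [h, hN.eventually_ge_atTop 1, hy_top.eventually_ge_atTop 1] with n hn h1 h2
    have hNpos : 0 < N n := by linarith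
    have hpow : 0 < N n ^ e n := Real.rpow_pos_of_pos hNpos _
    have hN1 : 0 < N (n + 1) := lt_of_lt_of_le (by positivity) hn.1
    have h3 := Real.log_le_log (by positivity) hn.1
    have h4 := Real.log_le_log hN1 hn.2
    rw [Real.log_mul hC₁.ne' hpow.ne', Real.log_rpow hNpos] at h3
    rw [Real.log_mul hC₂.ne' hpow.ne', Real.log_rpow hNpos] at h4
    have hyn : 0 < y n := by linarith
    have hen : 0 < e n := by linarith [he n]
    have h5 : |y (n + 1) - e n * y n| ≤ K := by
      rw [abs_le]
      constructor
      · have := (neg_abs_le (Real.log C₁)).trans' (neg_le_neg (le_max_left _ |Real.log C₂|))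
        simp only [hy, hK]; linarith
      · have := (le_abs_self (Real.log C₂)).trans (le_max_right |Real.log C₁| _)
        simp only [hy, hK]; linarith
    rw [div_sub_one (by positivity), abs_div, abs_of_pos (by positivity : 0 < e n * y n)]
    refine div_le_div₀ (le_trans (abs_nonneg _) (le_max_left _ _)) h5 hyn ?_
    nlinarith [he n]
  have hratio : Tendsto (fun n => y (n + 1) / (e n * y n)) atTop (𝓝 1) := by
    rw [tendsto_iff_dist_tendsto_zero]
    refine squeeze_zero' (Eventually.of_forall fun _ => dist_nonneg) ?_
      (hy_top.const_div_atTop K)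
    simpa [Real.dist_eq] using hstep
  have hδ : Tendsto (fun n => z (n + 1) - z n - Real.log (e n)) atTop (𝓝 0) := by
    have hlog : Tendsto (fun n => Real.log (y (n + 1) / (e n * y n))) atTop (𝓝 0) := by
      simpa using hratio.log one_ne_zero
    refine hlog.congr' ?_
    filter_upwards [hzy, (tendsto_add_atTop_nat 1).eventually hzy, hy_top.eventually_ge_atTop 1,
      (tendsto_add_atTop_nat 1).eventually (hy_top.eventually_ge_atTop 1)] with n h1 h2 h3 h4
    have hen : 0 < e n := by linarith [he n]
    rw [h1, h2, Real.log_div (by linarith) (by positivity), Real.log_mul hen.ne' (by linarith)]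
    ring
  have hces := hδ.cesaro
  have h0 : Tendsto (fun n : ℕ => z 0 / (n : ℝ)) atTop (𝓝 0) :=
    tendsto_natCast_atTop_atTop.const_div_atTop _
  have hsum := hces.add h0
  rw [add_zero] at hsum
  refine hsum.congr fun n => ?_
  rw [Finset.sum_sub_distrib, Finset.sum_range_sub]
  simp only [hz]
  ring

theorem mean_mem_Icc {u : ℕ → ℝ} {α β : ℝ} (hu : ∀ k, u k ∈ Set.Icc α β) {n : ℕ} (hn : 0 < n) :
    (1 / (n : ℝ)) * ∑ k ∈ Finset.range n, u k ∈ Set.Icc α β := by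
  have hn' : (0 : ℝ) < n := Nat.cast_pos.2 hn
  have h1 := Finset.card_nsmul_le_sum (Finset.range n) u α fun k _ => (hu k).1
  have h2 := Finset.sum_le_card_nsmul (Finset.range n) u β fun k _ => (hu k).2
  rw [Finset.card_range, nsmul_eq_mul] at h1 h2
  rw [one_div_mul_eq_div]
  exact ⟨(le_div_iff₀ hn').2 (by linarith), (div_le_iff₀ hn').2 (by linarith)⟩

theorem limsup_mem_Icc_of_tendsto_sub {u w : ℕ → ℝ} {α β : ℝ}
    (h : Tendsto (fun n => u n - w n) atTop (𝓝 0)) (hw : ∀ᶠ n in atTop, w n ∈ Set.Icc α β) :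
    limsup u atTop ∈ Set.Icc α β := by
  have hlo : ∀ ε > 0, ∀ᶠ n in atTop, α - ε ≤ u n := fun ε hε => by
    filter_upwards [hw, h.eventually (Ioi_mem_nhds (neg_lt_zero.2 hε))] with n h1 h2
    have := h1.1
    have h2 : -ε < u n - w n := h2
    linarith
  have hhi : ∀ ε > 0, ∀ᶠ n in atTop, u n ≤ β + ε := fun ε hε => by
    filter_upwards [hw, h.eventually (Iio_mem_nhds hε)] with n h1 h2
    have := h1.2
    have h2 : u n - w n < ε := h2
    linarith
  have hbdd : IsBoundedUnder (· ≤ ·) atTop u := ⟨β + 1, hhi 1 one_pos⟩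
  have hcob : IsCoboundedUnder (· ≤ ·) atTop u :=
    IsBoundedUnder.isCoboundedUnder_le ⟨α - 1, hlo 1 one_pos⟩
  constructor
  · refine le_of_forall_pos_le_add fun ε hε => ?_
    have := le_limsup_of_frequently_le (hlo ε hε).frequently hbdd
    linarith
  · refine le_of_forall_pos_le_add fun ε hε => ?_
    exact limsup_le_of_le hcob (hhi ε hε)

/-- Every number between `α` and `β` is the mean of a sequence of `α`s and `β`s. -/
theorem exists_tendsto_mean {α β r : ℝ} (hr : r ∈ Set.Icc α β) :
    ∃ s : ℕ → Bool, Tendsto (fun n : ℕ => (1 / (n : ℝ)) *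
      ∑ k ∈ Finset.range n, (if s k then β else α)) atTop (𝓝 r) := by
  obtain ⟨θ, hθ0, hθ1, hθ⟩ : ∃ θ : ℝ, 0 ≤ θ ∧ θ ≤ 1 ∧ α + θ * (β - α) = r := by
    rcases hr.1.trans hr.2 |>.eq_or_lt with h | h
    · exact ⟨0, le_rfl, zero_le_one, by linarith [hr.1, hr.2]⟩
    · refine ⟨(r - α) / (β - α), div_nonneg (by linarith [hr.1]) (by linarith),
        (div_le_one (by linarith)).2 (by linarith [hr.2]), ?_⟩
      rw [div_mul_cancel₀ _ (by linarith)]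
      ring
  -- Choose `β` exactly when `⌊θ n⌋` jumps; since `θ ≤ 1`, the jumps are at most 1, and `β` has
  -- density `θ`.
  set m : ℕ → ℕ := fun n => ⌊θ * n⌋₊ with hm
  have hstep : ∀ n, m (n + 1) = m n ∨ m (n + 1) = m n + 1 := by
    intro n
    have h0 : 0 ≤ θ * n := by positivity
    have h1 : m n ≤ m (n + 1) := Nat.floor_le_floor (by push_cast; nlinarith)
    have h2 : m (n + 1) ≤ m n + 1 := by
      simp only [hm]
      rw [← Nat.floor_add_one h0]
      exact Nat.floor_le_floor (by push_cast; nlinarith)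
    omega
  refine ⟨fun k => decide (m (k + 1) = m k + 1), ?_⟩
  have hsum : ∀ n, ∑ k ∈ Finset.range n, (if decide (m (k + 1) = m k + 1) then β else α) =
      n * α + m n * (β - α) := by
    intro n
    induction n with
    | zero => simp [hm]
    | succ n ih =>
      rw [Finset.sum_range_succ, ih]
      rcases hstep n with h | h
      · rw [h]; simp; ring
      · rw [h]; simp; ring
  have hlim : Tendsto (fun n : ℕ => α + (m n : ℝ) / n * (β - α)) atTop (𝓝 r) := by
    rw [← hθ]
    have h1 := (tendsto_nat_floor_mul_div_atTop hθ0).comp (tendsto_natCast_atTop_atTop (R := ℝ))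
    exact tendsto_const_nhds.add (h1.mul_const _)
  refine hlim.congr' ?_
  filter_upwards [eventually_gt_atTop 0] with n hn
  have hn' : (n : ℝ) ≠ 0 := Nat.cast_ne_zero.2 hn.ne'
  rw [hsum]
  field_simp

/-! ### The leading form of a polynomial map and the indeterminacy set -/

open MvPolynomial in
theorem exists_norm_eval_le (q : MvPolynomial (Fin 2) ℂ) (m : ℕ)
    (hm : ∀ s ∈ q.support, s.degree ≤ m) :
    ∃ C : ℝ, 0 ≤ C ∧ ∀ p : C2, 1 ≤ ‖p‖ → ‖eval (fun j => p j) q‖ ≤ C * ‖p‖ ^ m := by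
  refine ⟨∑ s ∈ q.support, ‖coeff s q‖, Finset.sum_nonneg fun _ _ => norm_nonneg _,
    fun p hp => ?_⟩
  rw [eval_eq', Finset.sum_mul]
  refine (norm_sum_le _ _).trans (Finset.sum_le_sum fun s hs => ?_)
  rw [norm_mul, norm_prod]
  gcongr
  calc ∏ i, ‖p i ^ s i‖ ≤ ∏ i, ‖p‖ ^ s i := by
        refine Finset.prod_le_prod (fun _ _ => norm_nonneg _) fun i _ => ?_
        rw [norm_pow]
        gcongr
        exact PiLp.norm_apply_le p i
    _ = ‖p‖ ^ s.degree := by rw [Finset.prod_pow_eq_pow_sum, Finsupp.degree_eq_sum]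
    _ ≤ ‖p‖ ^ m := pow_le_pow_right₀ hp (hm s hs)

/-- The homogeneous part of degree `mapDegree f` of a polynomial map. -/
noncomputable def topPart (f : Fin 2 → MvPolynomial (Fin 2) ℂ) (p : C2) : C2 :=
  WithLp.toLp 2 (fun i =>
    MvPolynomial.eval (fun j => p j) (MvPolynomial.homogeneousComponent (mapDegree f) (f i)))

open MvPolynomial in
theorem exists_norm_polyMap_sub_topPart_le (f : Fin 2 → MvPolynomial (Fin 2) ℂ) :
    ∃ C : ℝ, 0 < C ∧ ∀ p : C2, 1 ≤ ‖p‖ →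
      ‖polyMap f p - topPart f p‖ ≤ C * ‖p‖ ^ (mapDegree f - 1) := by
  have key : ∀ i, ∃ C : ℝ, 0 ≤ C ∧ ∀ p : C2, 1 ≤ ‖p‖ →
      ‖(polyMap f p - topPart f p) i‖ ≤ C * ‖p‖ ^ (mapDegree f - 1) := by
    intro i
    obtain ⟨C, hC, h⟩ := exists_norm_eval_le (f i - homogeneousComponent (mapDegree f) (f i))
      (mapDegree f - 1) (by
        intro s hs
        rw [mem_support_iff, coeff_sub, coeff_homogeneousComponent] at hs
        have h1 : s.degree ≠ mapDegree f := by
          intro h; rw [if_pos h, sub_self] at hs; exact hs rfl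
        rw [if_neg h1, sub_zero] at hs
        have h2 : s.degree ≤ (f i).totalDegree := by
          rw [Finsupp.degree_eq_sum]
          simpa [Finsupp.sum_fintype] using le_totalDegree (mem_support_iff.2 hs)
        have h3 : (f i).totalDegree ≤ mapDegree f := by
          fin_cases i
          · exact le_max_left _ _
          · exact le_max_right _ _
        omega)
    exact ⟨C, hC, fun p hp => by simpa [polyMap, topPart] using h p hp⟩
  obtain ⟨C₀, hC₀, h₀⟩ := key 0
  obtain ⟨C₁, hC₁, h₁⟩ := key 1
  refine ⟨C₀ + C₁ + 1, by positivity, fun p hp => ?_⟩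
  have h2 : ‖polyMap f p - topPart f p‖ ≤
      ‖(polyMap f p - topPart f p) 0‖ + ‖(polyMap f p - topPart f p) 1‖ := by
    refine le_of_sq_le_sq ?_ (by positivity)
    rw [EuclideanSpace.norm_sq_eq, Fin.sum_univ_two]
    nlinarith [norm_nonneg ((polyMap f p - topPart f p) 0),
      norm_nonneg ((polyMap f p - topPart f p) 1)]
  have h3 : 0 ≤ ‖p‖ ^ (mapDegree f - 1) := by positivity
  nlinarith [h₀ p hp, h₁ p hp]

theorem differentiable_eval (q : MvPolynomial (Fin 2) ℂ) :
    Differentiable ℂ fun p : C2 => MvPolynomial.eval (fun j => p j) q := by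
  simp only [MvPolynomial.eval_eq']
  fun_prop

theorem differentiable_polyMap (f : Fin 2 → MvPolynomial (Fin 2) ℂ) :
    Differentiable ℂ (polyMap f) := by
  rw [differentiable_euclidean]
  exact fun i => differentiable_eval (f i)

/-- A vector of the plane as a vector of homogeneous coordinates on the line at infinity. -/
def atInfinity (p : C2) : Fin 3 → ℂ := ![p 0, p 1, 0]

theorem atInfinity_smul (t : ℂ) (p : C2) : atInfinity (t • p) = t • atInfinity p := by
  ext i; fin_cases i <;> simp [atInfinity]

theorem atInfinity_ne_zero {p : C2} (hp : p ≠ 0) : atInfinity p ≠ 0 := by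
  intro h
  apply hp
  ext i
  fin_cases i
  · exact congrFun h 0
  · exact congrFun h 1

theorem homLift_atInfinity {f : Fin 2 → MvPolynomial (Fin 2) ℂ} (hd : 0 < mapDegree f) (p : C2) :
    homLift f (atInfinity p) = atInfinity (topPart f p) := by
  have key : ∀ g : MvPolynomial (Fin 2) ℂ, homogenizedEval (mapDegree f) g (atInfinity p) =
      MvPolynomial.eval (fun j => p j) (MvPolynomial.homogeneousComponent (mapDegree f) g) := by
    intro g
    unfold homogenizedEval
    have h1 : (![atInfinity p 0, atInfinity p 1] : Fin 2 → ℂ) = fun j => p j := by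
      ext i; fin_cases i <;> rfl
    rw [Finset.sum_eq_single (mapDegree f), h1]
    · simp
    · intro k hk hkd
      have h2 : mapDegree f - k ≠ 0 := by rw [Finset.mem_range] at hk; omega
      simp [atInfinity, h2]
    · simp
  ext i
  fin_cases i
  · exact key (f 0)
  · exact key (f 1)
  · simp [homLift, atInfinity, hd.ne']

theorem topPart_smul {f : Fin 2 → MvPolynomial (Fin 2) ℂ} (hd : 0 < mapDegree f) (t : ℂ) (p : C2) :
    topPart f (t • p) = t ^ mapDegree f • topPart f p := by
  have h1 := homLift_smul f t (atInfinity p)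
  rw [← atInfinity_smul, homLift_atInfinity hd, homLift_atInfinity hd, ← atInfinity_smul] at h1
  ext i
  fin_cases i
  · exact congrFun h1 0
  · exact congrFun h1 1

theorem exists_smul_rep (v : Fin 3 → ℂ) (hv : v ≠ 0) :
    ∃ t : ℂ, t ≠ 0 ∧ (Projectivization.mk ℂ v hv).rep = t • v := by
  obtain ⟨a, ha⟩ := Projectivization.exists_smul_eq_mk_rep ℂ v hv
  exact ⟨a, a.ne_zero, ha.symm⟩

theorem mk_mem_indeterminacySet {f : Fin 2 → MvPolynomial (Fin 2) ℂ} (v : Fin 3 → ℂ)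
    (hv : v ≠ 0) :
    (Projectivization.mk ℂ v hv : P2) ∈ indeterminacySet f ↔ homLift f v = 0 := by
  obtain ⟨t, ht, hrep⟩ := exists_smul_rep v hv
  simp [indeterminacySet, hrep, homLift_smul, ht]

theorem mapDegree_pos {f : Fin 2 → MvPolynomial (Fin 2) ℂ} (hattr : InfinityAttracting f) :
    0 < mapDegree f := by
  by_contra hd
  have hd0 : mapDegree f = 0 := by omega
  have h0 : ∀ i, (f i).totalDegree = 0 := by
    have h1 : (f 0).totalDegree ≤ mapDegree f := le_max_left _ _
    have h2 : (f 1).totalDegree ≤ mapDegree f := le_max_right _ _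
    intro i
    fin_cases i
    · exact Nat.le_zero.1 (hd0 ▸ h1)
    · exact Nat.le_zero.1 (hd0 ▸ h2)
  have hconst : ∀ p, polyMap f p = polyMap f 0 := by
    intro p
    unfold polyMap
    congr 1
    ext i
    rw [MvPolynomial.totalDegree_eq_zero_iff_eq_C.1 (h0 i)]
    simp
  obtain ⟨c, hc, R, hR⟩ := hattr
  obtain ⟨p, hp⟩ := NormedSpace.exists_lt_norm ℂ C2 (max R ‖polyMap f 0‖)
  have h1 := hR p ((le_max_left _ _).trans hp.le)
  rw [hconst] at h1
  have h2 := (le_max_right R ‖polyMap f 0‖).trans_lt hp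
  nlinarith [norm_nonneg (polyMap f 0)]

/-- The affine part of the homogeneous coordinates. -/
noncomputable def affinePart (v : Fin 3 → ℂ) : C2 := !₂[v 0, v 1]

theorem atInfinity_affinePart {v : Fin 3 → ℂ} (hv : v 2 = 0) : atInfinity (affinePart v) = v := by
  ext i; fin_cases i <;> simp [atInfinity, affinePart, hv]

theorem affinePart_atInfinity (p : C2) : affinePart (atInfinity p) = p := by
  ext i; fin_cases i <;> simp [atInfinity, affinePart]

theorem affinePart_ne_zero {v : Fin 3 → ℂ} (h0 : v ≠ 0) (hv : v 2 = 0) : affinePart v ≠ 0 := by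
  intro h
  apply h0
  rw [← atInfinity_affinePart hv, h]
  ext i; fin_cases i <;> simp [atInfinity]

theorem mem_indeterminacySet {f : Fin 2 → MvPolynomial (Fin 2) ℂ} (hd : 0 < mapDegree f) {x : P2} :
    x ∈ indeterminacySet f ↔ x.rep 2 = 0 ∧ topPart f (affinePart x.rep) = 0 := by
  have hz : ∀ p : C2, atInfinity p = 0 ↔ p = 0 := fun p =>
    ⟨fun h => by by_contra hp; exact atInfinity_ne_zero hp h, fun h => by
      rw [h]; ext i; fin_cases i <;> simp [atInfinity]⟩
  constructor
  · intro hx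
    have hx : homLift f x.rep = 0 := hx
    have h2 : x.rep 2 = 0 := by
      have := congrFun hx 2
      simpa [homLift, hd.ne'] using this
    refine ⟨h2, ?_⟩
    rwa [← hz, ← homLift_atInfinity hd, atInfinity_affinePart h2]
  · rintro ⟨h2, h⟩
    change homLift f x.rep = 0
    rwa [← atInfinity_affinePart h2, homLift_atInfinity hd, hz]

/-- If the line at infinity is contracted to a point that is not indeterminate, then the
polynomial map has a leading form, and its zero lines are the points of indeterminacy. -/
theorem exists_leadingForm {f : Fin 2 → MvPolynomial (Fin 2) ℂ} (hattr : InfinityAttracting f)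
    {X : P2} (himage : imageOfLineAtInfinity f = {X}) (hX : X ∉ indeterminacySet f) :
    X.rep 2 = 0 ∧ ∃ h : C2 → ℂ, LeadingForm (polyMap f) h (mapDegree f) (affinePart X.rep) ∧
      ∀ p, topPart f p = h p • affinePart X.rep := by
  have hd := mapDegree_pos hattr
  obtain ⟨x, hx, hxL, hxX⟩ : X ∈ imageOfLineAtInfinity f := himage ▸ rfl
  have hxL : x.rep 2 = 0 := hxL
  have hX2 : X.rep 2 = 0 := by
    have h1 : homLift f x.rep 2 = 0 := by
      rw [← atInfinity_affinePart hxL, homLift_atInfinity hd]; rfl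
    obtain ⟨t, ht, hrep⟩ := exists_smul_rep _ hx
    rw [← hxX]
    change (Projectivization.mk ℂ (homLift f x.rep) hx).rep 2 = 0
    rw [hrep, Pi.smul_apply, h1, smul_zero]
  refine ⟨hX2, ?_⟩
  set X₀ := affinePart X.rep with hX₀
  have hX₀0 : X₀ ≠ 0 := affinePart_ne_zero X.rep_nonzero hX2
  have hpar : ∀ p, ∃ t : ℂ, topPart f p = t • X₀ := by
    intro p
    by_cases hp : topPart f p = 0
    · exact ⟨0, by rw [hp, zero_smul]⟩
    have hp0 : p ≠ 0 := by
      rintro rfl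
      have := topPart_smul hd 0 (0 : C2)
      rw [zero_smul, zero_pow hd.ne', zero_smul] at this
      exact hp this
    set y : P2 := Projectivization.mk ℂ (atInfinity p) (atInfinity_ne_zero hp0) with hy
    have hyI : y ∉ indeterminacySet f := by
      rw [hy, mk_mem_indeterminacySet, homLift_atInfinity hd]
      exact atInfinity_ne_zero hp
    obtain ⟨t, ht, hrep⟩ := exists_smul_rep (atInfinity p) (atInfinity_ne_zero hp0)
    have hyL : y ∈ lineAtInfinity := by
      change y.rep 2 = 0
      rw [hy, hrep]; simp [atInfinity]
    have hyX : extension f y hyI = X := by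
      have : extension f y hyI ∈ imageOfLineAtInfinity f := ⟨y, hyI, hyL, rfl⟩
      rwa [himage] at this
    have h1 : y.rep = atInfinity (t • p) := by rw [atInfinity_smul]; exact hrep
    have h2 : X.rep = atInfinity (affinePart X.rep) := (atInfinity_affinePart hX2).symm
    rw [← Projectivization.mk_rep X] at hyX
    obtain ⟨s, hs⟩ := (Projectivization.mk_eq_mk_iff' ℂ _ _ _ _).1 hyX
    rw [h1, homLift_atInfinity hd, h2, ← atInfinity_smul, topPart_smul hd] at hs
    have h3 := congrArg affinePart hs
    rw [affinePart_atInfinity, affinePart_atInfinity] at h3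
    refine ⟨(t ^ mapDegree f)⁻¹ * s, ?_⟩
    rw [mul_smul, h3, inv_smul_smul₀ (pow_ne_zero _ ht)]
  obtain ⟨i, hi⟩ : ∃ i, X₀ i ≠ 0 := by
    by_contra hcon
    push Not at hcon
    exact hX₀0 (by ext i; exact hcon i)
  -- Dividing one coordinate of the top part by a nonzero coordinate of `X₀` makes the factor of
  -- proportionality a polynomial, hence entire.
  set h : C2 → ℂ := fun p => (X₀ i)⁻¹ * topPart f p i with hh
  have htop : ∀ p, topPart f p = h p • X₀ := by
    intro p
    obtain ⟨t, ht⟩ := hpar p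
    have : h p = t := by
      simp only [hh, ht, PiLp.smul_apply, smul_eq_mul]
      field_simp
    rw [this, ht]
  refine ⟨h, ⟨differentiable_polyMap f, ?_, ?_, ?_, hX₀0, hd, ?_, hattr⟩, htop⟩
  · exact (differentiable_eval _).const_mul _
  · intro t p
    simp only [hh, topPart_smul hd, PiLp.smul_apply, smul_eq_mul]
    ring
  · intro h0
    refine hX ((mem_indeterminacySet hd).2 ⟨hX2, ?_⟩)
    rw [← hX₀, htop, h0, zero_smul]
  · obtain ⟨C, hC, hle⟩ := exists_norm_polyMap_sub_topPart_le f
    exact ⟨C, hC, fun p hp => by rw [← htop]; exact hle p hp⟩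

/-- The leading form, along a line that avoids the origin in the direction of `X₀`, is a
polynomial with finitely many zeros, and at least one. -/
theorem LeadingForm.exists_polynomial {f : Fin 2 → MvPolynomial (Fin 2) ℂ} {h : C2 → ℂ} {X₀ : C2}
    (H : LeadingForm (polyMap f) h (mapDegree f) X₀) (htop : ∀ p, topPart f p = h p • X₀)
    (Y : C2) : {s : ℂ | h (Y + s • X₀) = 0}.Finite ∧ ∃ s : ℂ, h (Y + s • X₀) = 0 := by
  obtain ⟨i, hi⟩ : ∃ i, X₀ i ≠ 0 := by
    by_contra hcon
    push Not at hcon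
    exact H.vertex_ne_zero (by ext i; exact hcon i)
  set Q : Polynomial ℂ := MvPolynomial.aeval
    (fun j => Polynomial.C (Y j) + Polynomial.X * Polynomial.C (X₀ j))
    (MvPolynomial.homogeneousComponent (mapDegree f) (f i)) with hQ
  have hQe : ∀ s, Q.eval s = X₀ i * h (Y + s • X₀) := by
    intro s
    have h1 : topPart f (Y + s • X₀) i = h (Y + s • X₀) * X₀ i := by
      rw [htop, PiLp.smul_apply, smul_eq_mul]
    rw [mul_comm, ← h1, hQ, topPart]
    change Polynomial.evalRingHom s _ = _
    rw [MvPolynomial.aeval_def, MvPolynomial.hom_eval₂, MvPolynomial.eval, MvPolynomial.eval₂Hom]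
    simp only [RingHom.coe_mk, MonoidHom.coe_mk, OneHom.coe_mk]
    congr 1
    · ext; simp
    · ext j
      simp [mul_comm (X₀ j) s]
  have hroot : ∀ s, Q.eval s = 0 ↔ h (Y + s • X₀) = 0 := by
    intro s; rw [hQe]; simp [hi]
  have hdeg : Q.degree ≠ 0 ∧ Q ≠ 0 := by
    -- By homogeneity `X₀ i * h (t • Y + X₀) = t ^ d * Q(1 / t)`, with `d` the degree of the map.
    -- For constant `Q`, letting `t` tend to 0 would give `h X₀ = 0`.
    have hnc : ∀ c, Q ≠ Polynomial.C c := by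
      intro c hc
      have h1 : ∀ t : ℂ, t ≠ 0 → X₀ i * h (t • Y + X₀) = t ^ mapDegree f * c := by
        intro t ht
        have h2 : t • Y + X₀ = t • (Y + t⁻¹ • X₀) := by rw [smul_add, smul_inv_smul₀ ht]
        rw [h2, H.lead_smul, mul_left_comm, ← hQe, hc, Polynomial.eval_C]
      have hc1 : Continuous fun t : ℂ => X₀ i * h (t • Y + X₀) :=
        continuous_const.mul (H.differentiable_lead.continuous.comp (by fun_prop))
      have hc2 : Continuous fun t : ℂ => t ^ mapDegree f * c := by fun_prop
      have h3 := hc1.ext_on (dense_compl_singleton (0 : ℂ)) hc2 (fun t ht => h1 t ht)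
      have h4 := congrFun h3 0
      simp only [zero_smul, zero_add, zero_pow H.degree_pos.ne', zero_mul, mul_eq_zero] at h4
      exact h4.elim hi H.lead_ne_zero
    refine ⟨fun h0 => hnc _ (Polynomial.eq_C_of_degree_eq_zero h0), fun h0 => hnc 0 ?_⟩
    rw [h0, map_zero]
  constructor
  · refine (Q.roots.toFinset.finite_toSet).subset fun s hs => ?_
    simp only [Finset.mem_coe, Multiset.mem_toFinset]
    rw [Polynomial.mem_roots hdeg.2]
    exact (hroot s).2 hs
  · obtain ⟨s, hs⟩ := IsAlgClosed.exists_root Q hdeg.1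
    exact ⟨s, (hroot s).1 hs⟩

theorem finite_nonempty_indeterminacySet {f : Fin 2 → MvPolynomial (Fin 2) ℂ} {h : C2 → ℂ}
    {X₀ : C2} (H : LeadingForm (polyMap f) h (mapDegree f) X₀)
    (htop : ∀ p, topPart f p = h p • X₀) :
    (indeterminacySet f).Finite ∧ (indeterminacySet f).Nonempty := by
  have hd := H.degree_pos
  -- The line `Y + s • X₀` meets every direction except that of `X₀`, where `h` does not vanish.
  set Y := perp X₀ with hY
  have hw : wedge X₀ Y ≠ 0 := by
    rw [hY, wedge_perp]
    exact_mod_cast pow_ne_zero 2 (norm_ne_zero_iff.2 H.vertex_ne_zero)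
  have hne : ∀ s : ℂ, Y + s • X₀ ≠ 0 := by
    intro s h0
    apply hw
    have : wedge X₀ (Y + s • X₀) = wedge X₀ Y := by
      rw [wedge_add, wedge_smul, wedge_self, mul_zero, add_zero]
    rw [← this, h0]
    simp [wedge]
  obtain ⟨hfin, s, hs⟩ := H.exists_polynomial htop Y
  constructor
  · refine (hfin.image fun s => (Projectivization.mk ℂ (atInfinity (Y + s • X₀))
      (atInfinity_ne_zero (hne s)) : P2)).subset fun x hx => ?_
    obtain ⟨hx2, hx0⟩ := (mem_indeterminacySet hd).1 hx
    set u := affinePart x.rep with hu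
    have hhu : h u = 0 := by
      rw [htop] at hx0
      exact (smul_eq_zero.1 hx0).resolve_right H.vertex_ne_zero
    obtain ⟨a, b, hab⟩ : ∃ a b : ℂ, u = a • Y + b • X₀ := ⟨_, _, eq_add_perp H.vertex_ne_zero u⟩
    have ha : a ≠ 0 := by
      rintro rfl
      rw [zero_smul, zero_add] at hab
      have hu0 : u ≠ 0 := affinePart_ne_zero x.rep_nonzero hx2
      have hb : b ≠ 0 := by rintro rfl; exact hu0 (by rw [hab, zero_smul])
      rw [hab, H.lead_smul] at hhu
      exact (mul_eq_zero.1 hhu).elim (pow_ne_zero _ hb) H.lead_ne_zero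
    have hu' : u = a • (Y + (a⁻¹ * b) • X₀) := by
      rw [hab, smul_add, smul_smul, mul_inv_cancel_left₀ ha]
    refine ⟨a⁻¹ * b, ?_, ?_⟩
    · rw [hu', H.lead_smul] at hhu
      exact (mul_eq_zero.1 hhu).resolve_left (pow_ne_zero _ ha)
    · rw [← Projectivization.mk_rep x]
      refine (Projectivization.mk_eq_mk_iff' ℂ _ _ _ _).2 ⟨a⁻¹, ?_⟩
      rw [← atInfinity_affinePart hx2, ← hu, hu', atInfinity_smul, inv_smul_smul₀ ha]
  · refine ⟨Projectivization.mk ℂ (atInfinity (Y + s • X₀)) (atInfinity_ne_zero (hne s)), ?_⟩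
    rw [mk_mem_indeterminacySet, homLift_atInfinity hd, htop, hs, zero_smul]
    ext i; fin_cases i <;> simp [atInfinity]

/-! ### Neighborhoods in the projective plane and cones in the affine plane -/

theorem norm_perp (v : C2) : ‖perp v‖ = ‖v‖ := by
  refine (sq_eq_sq₀ (norm_nonneg _) (norm_nonneg _)).1 ?_
  simp [perp, EuclideanSpace.norm_sq_eq, Fin.sum_univ_two, add_comm]

theorem affinePart_smul (t : ℂ) (v : Fin 3 → ℂ) : affinePart (t • v) = t • affinePart v := by
  ext i; fin_cases i <;> simp [affinePart]

theorem continuous_affinePart : Continuous affinePart := by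
  unfold affinePart
  refine (PiLp.continuous_toLp 2 _).comp (continuous_pi fun i => ?_)
  fin_cases i
  · exact continuous_apply 0
  · exact continuous_apply 1

/-- The homogeneous coordinates `(z, w, 1)`. -/
def affineCoords (p : C2) : Fin 3 → ℂ := ![p 0, p 1, 1]

theorem affineCoords_ne_zero (p : C2) : affineCoords p ≠ 0 := fun h =>
  one_ne_zero (congrFun h 2)

theorem toP2_eq (p : C2) :
    toP2 p = Projectivization.mk ℂ (affineCoords p) (affineCoords_ne_zero p) := rfl

theorem affinePart_affineCoords (p : C2) : affinePart (affineCoords p) = p := by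
  ext i; fin_cases i <;> simp [affineCoords, affinePart]

/-- A neighborhood of a point at infinity contains a thin cone, near infinity. -/
theorem eventually_toP2_mem {x : P2} (hx : x.rep 2 = 0) {W : Set P2} (hW : W ∈ 𝓝 x) :
    ∀ᶠ ρ in 𝓝[>] (0 : ℝ), ∀ᶠ R in atTop, ∀ p : C2, R ≤ ‖p‖ →
      ‖wedge (affinePart x.rep) p‖ ≤ ρ * ‖p‖ → toP2 p ∈ W := by
  obtain ⟨O, hOW, hO, hxO⟩ := mem_nhds_iff.1 hW
  have hpre : IsOpen ((Projectivization.mk' ℂ : {v : Fin 3 → ℂ // v ≠ 0} → P2) ⁻¹' O) :=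
    isOpen_coinduced.1 hO
  obtain ⟨S, hS, hSO⟩ := isOpen_induced_iff.1 hpre
  have hxS : x.rep ∈ S := by
    have h1 : (⟨x.rep, x.rep_nonzero⟩ : {v : Fin 3 → ℂ // v ≠ 0}) ∈ Subtype.val ⁻¹' S := by
      rw [hSO, Set.mem_preimage, Projectivization.mk'_eq_mk, Projectivization.mk_rep]
      exact hxO
    exact h1
  obtain ⟨ε, hε, hball⟩ := Metric.isOpen_iff.1 hS _ hxS
  set u := affinePart x.rep with hu
  have hu0 : 0 < ‖u‖ := norm_pos_iff.2 (affinePart_ne_zero x.rep_nonzero hx)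
  have small : ∀ c : ℝ, 0 < c → ∀ᶠ ρ in 𝓝[>] (0 : ℝ), ρ < c := fun c hc =>
    mem_nhdsWithin_of_mem_nhds (Iio_mem_nhds hc)
  filter_upwards [small _ hε, small _ hu0] with ρ hρε hρu
  filter_upwards [eventually_gt_atTop 0, eventually_gt_atTop (‖u‖ / ε)] with R hR0 hRε p hp hcone
  have hp0 : 0 < ‖p‖ := hR0.trans_le hp
  have hpne : p ≠ 0 := norm_pos_iff.1 hp0
  -- `t • p` is the orthogonal projection of `u` on the line of `p`. Scaling the coordinates `(p,
  -- 1)` by `t` brings them near `(u, 0)`: the planar error is at most `ρ`, and `‖t‖ ≤ ‖u‖ / ‖p‖`.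
  set t : ℂ := inner ℂ p u / ((‖p‖ ^ 2 : ℝ) : ℂ) with ht
  have hdec := eq_add_perp hpne u
  have hnorm : ‖((‖p‖ ^ 2 : ℝ) : ℂ)‖ = ‖p‖ ^ 2 := by
    rw [Complex.norm_real, norm_pow, norm_norm]
  have hdist : ‖t • p - u‖ ≤ ρ := by
    have h1 : t • p - u = -((wedge p u / ((‖p‖ ^ 2 : ℝ) : ℂ)) • perp p) := by
      conv_lhs => rw [hdec]
      rw [← ht]; abel
    rw [h1, norm_neg, norm_smul, norm_perp, norm_div, hnorm, wedge_comm, norm_neg]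
    rw [div_mul_eq_mul_div, div_le_iff₀ (by positivity)]
    nlinarith
  have htn : ‖t‖ < ε := by
    rw [ht, norm_div, hnorm, div_lt_iff₀ (by positivity)]
    have h1 := norm_inner_le_norm (𝕜 := ℂ) p u
    have h2 := (div_lt_iff₀ hε).1 (hRε.trans_le hp)
    nlinarith
  have ht0 : t ≠ 0 := by
    intro h0
    rw [h0, zero_smul, zero_sub, norm_neg] at hdist
    linarith
  have hne : t • affineCoords p ≠ 0 := smul_ne_zero ht0 (affineCoords_ne_zero p)
  have hmem : t • affineCoords p ∈ S := by
    apply hball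
    rw [Metric.mem_ball, dist_pi_lt_iff hε]
    have h0 : ‖(t • p - u) 0‖ < ε := (PiLp.norm_apply_le _ 0).trans_lt (hdist.trans_lt hρε)
    have h1 : ‖(t • p - u) 1‖ < ε := (PiLp.norm_apply_le _ 1).trans_lt (hdist.trans_lt hρε)
    intro i
    rw [dist_eq_norm]
    fin_cases i
    · simpa [affineCoords, hu, affinePart] using h0
    · simpa [affineCoords, hu, affinePart] using h1
    · simpa [affineCoords, hx] using htn
  have hmk : toP2 p = Projectivization.mk ℂ (t • affineCoords p) hne := by
    rw [toP2_eq]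
    exact ((Projectivization.mk_eq_mk_iff' ℂ _ _ _ _).2 ⟨t, rfl⟩).symm
  apply hOW
  have h1 : (⟨_, hne⟩ : {v : Fin 3 → ℂ // v ≠ 0}) ∈ Subtype.val ⁻¹' S := hmem
  rw [hSO, Set.mem_preimage, Projectivization.mk'_eq_mk] at h1
  rw [hmk]
  exact h1

/-- Both sides scale by `‖t‖`, so the inequality does not depend on the representative, and its
preimage among nonzero vectors is open. -/
theorem isOpen_setOf_rep_lt {φ ψ : (Fin 3 → ℂ) → ℝ} (hφ : Continuous φ) (hψ : Continuous ψ)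
    (hφs : ∀ (t : ℂ) v, φ (t • v) = ‖t‖ * φ v) (hψs : ∀ (t : ℂ) v, ψ (t • v) = ‖t‖ * ψ v) :
    IsOpen {y : P2 | φ y.rep < ψ y.rep} ∧
      ∀ v hv, (Projectivization.mk ℂ v hv : P2) ∈ {y : P2 | φ y.rep < ψ y.rep} ↔ φ v < ψ v := by
  have key : ∀ v hv, (Projectivization.mk ℂ v hv : P2) ∈ {y : P2 | φ y.rep < ψ y.rep} ↔
      φ v < ψ v := by
    intro v hv
    obtain ⟨t, ht, hrep⟩ := exists_smul_rep v hv
    rw [Set.mem_ofPred_eq, hrep, hφs, hψs, mul_lt_mul_iff_right₀ (norm_pos_iff.2 ht)]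
  refine ⟨?_, key⟩
  refine isOpen_coinduced.2 ?_
  have h1 : (Projectivization.mk' ℂ : {v : Fin 3 → ℂ // v ≠ 0} → P2) ⁻¹'
      {y : P2 | φ y.rep < ψ y.rep} = {v | φ v.1 < ψ v.1} := by
    ext v
    rw [Set.mem_preimage, Projectivization.mk'_eq_mk, key]
    rfl
  rw [h1]
  exact isOpen_lt (hφ.comp continuous_subtype_val) (hψ.comp continuous_subtype_val)

theorem eventually_norm_gt_of_tendsto {X : P2} (hX : X.rep 2 = 0) {q : ℕ → C2}
    (hq : Tendsto (fun n => toP2 (q n)) atTop (𝓝 X)) (R : ℝ) : ∀ᶠ n in atTop, R < ‖q n‖ := by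
  obtain ⟨hopen, hmk⟩ := isOpen_setOf_rep_lt (φ := fun v => R * ‖v 2‖)
    (ψ := fun v => ‖affinePart v‖) (by fun_prop) continuous_affinePart.norm
    (fun t v => by simp; ring) (fun t v => by rw [affinePart_smul, norm_smul])
  have hXmem : X ∈ {y : P2 | R * ‖y.rep 2‖ < ‖affinePart y.rep‖} := by
    rw [Set.mem_ofPred_eq, hX, norm_zero, mul_zero]
    exact norm_pos_iff.2 (affinePart_ne_zero X.rep_nonzero hX)
  filter_upwards [hq (hopen.mem_nhds hXmem)] with n hn
  have h1 : R * ‖affineCoords (q n) 2‖ < ‖affinePart (affineCoords (q n))‖ :=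
    (hmk _ (affineCoords_ne_zero (q n))).1 hn
  rw [affinePart_affineCoords] at h1
  simpa [affineCoords] using h1

theorem eventually_wedge_gt_of_tendsto {X : P2} {q : ℕ → C2}
    (hq : Tendsto (fun n => toP2 (q n)) atTop (𝓝 X)) {u : C2} {ρ : ℝ}
    (hu : ρ * ‖affinePart X.rep‖ < ‖wedge u (affinePart X.rep)‖) :
    ∀ᶠ n in atTop, ρ * ‖q n‖ < ‖wedge u (q n)‖ := by
  obtain ⟨hopen, hmk⟩ := isOpen_setOf_rep_lt (φ := fun v => ρ * ‖affinePart v‖)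
    (ψ := fun v => ‖wedge u (affinePart v)‖) (continuous_const.mul continuous_affinePart.norm)
    ((continuous_wedge u).comp continuous_affinePart).norm
    (fun t v => by rw [affinePart_smul, norm_smul]; ring)
    (fun t v => by rw [affinePart_smul, wedge_smul, norm_mul])
  filter_upwards [hq (hopen.mem_nhds hu)] with n hn
  have := (hmk _ (affineCoords_ne_zero (q n))).1 hn
  simpa [affinePart_affineCoords] using this

theorem tendsto_toP2_of_wedge_le {X : P2} (hX : X.rep 2 = 0) {q : ℕ → C2}
    (hq : Tendsto (fun n => ‖q n‖) atTop atTop)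
    (hw : ∀ η > 0, ∀ᶠ n in atTop, ‖wedge (affinePart X.rep) (q n)‖ ≤ η * ‖q n‖) :
    Tendsto (fun n => toP2 (q n)) atTop (𝓝 X) := by
  intro W hW
  obtain ⟨ρ, hρ, hρ0⟩ := ((eventually_toP2_mem hX hW).and self_mem_nhdsWithin).exists
  obtain ⟨R, hR⟩ := hρ.exists
  change ∀ᶠ n in atTop, toP2 (q n) ∈ W
  filter_upwards [hw ρ hρ0, hq.eventually_ge_atTop R] with n h1 h2
  exact hR _ h2 h1

/-! ### Escape rates of bounded orbits and of orbits outside the cones -/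

theorem hasEscapeRate_of_tendsto {f : Fin 2 → MvPolynomial (Fin 2) ℂ} {p : C2} {L : ℝ}
    (h : Tendsto (escapeSeq f p) atTop (𝓝 L)) : HasEscapeRate f p (Real.exp L) := by
  simp only [HasEscapeRate, lowerEscapeRate, upperEscapeRate, h.limsup_eq, h.liminf_eq, and_self]

theorem upperEscapeRate_eq_one_of_bounded {f : Fin 2 → MvPolynomial (Fin 2) ℂ} {p : C2} {R : ℝ}
    (h : ∀ n, ‖(polyMap f)^[n] p‖ ≤ R) : upperEscapeRate f p = 1 := by
  have hR0 : 0 ≤ R := (norm_nonneg _).trans (h 0)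
  have hlim : Tendsto (escapeSeq f p) atTop (𝓝 0) := by
    refine squeeze_zero (g := fun n : ℕ => Real.posLog (Real.posLog R) / (n : ℝ))
      (fun n => mul_nonneg (by positivity) Real.posLog_nonneg) (fun n => ?_)
      (tendsto_natCast_atTop_atTop.const_div_atTop _)
    rw [escapeSeq, one_div_mul_eq_div]
    refine div_le_div_of_nonneg_right ?_ (Nat.cast_nonneg n)
    exact Real.posLog_le_posLog Real.posLog_nonneg
      (Real.posLog_le_posLog (norm_nonneg _) (h n))
  simpa using (hasEscapeRate_of_tendsto hlim).2

namespace ConeSystem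

variable {f : Fin 2 → MvPolynomial (Fin 2) ℂ} {h : C2 → ℂ} {d : ℕ} {X₀ : C2} {ι : Type*}
  {v : ι → C2} {ρ : ℝ}

/-- The complement of the cones is absorbing near infinity, and its points have escape rate `d`
and converge to the direction of `X₀`. -/
theorem eventually_escape_outside [Finite ι] (H : ConeSystem (polyMap f) h d X₀ v ρ) :
    ∀ᶠ R in atTop, ∀ (p : C2) (m : ℕ), R ≤ ‖(polyMap f)^[m] p‖ →
      (∀ i, ρ * ‖(polyMap f)^[m] p‖ ≤ ‖wedge (v i) ((polyMap f)^[m] p)‖) →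
      Tendsto (fun n => ‖(polyMap f)^[n] p‖) atTop atTop ∧
      (∀ η > 0, ∀ᶠ n in atTop,
        ‖wedge X₀ ((polyMap f)^[n] p)‖ ≤ η * ‖(polyMap f)^[n] p‖) ∧
      HasEscapeRate f p d := by
  obtain ⟨c, hc, hlead⟩ := H.exists_lead_ge
  obtain ⟨C, hC, hup⟩ := H.exists_norm_map_le
  have hX : 0 < ‖X₀‖ := norm_pos_iff.2 H.vertex_ne_zero
  filter_upwards [H.eventually_outside hc, H.eventually_norm_iterate_ge,
    H.eventually_tendsto_norm_iterate, H.eventually_norm_map_ge hc, eventually_ge_atTop 1]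
    with R hout hmono htend hge hR1 p m hm hfree
  have hsplit : ∀ n, (polyMap f)^[n + m] p = (polyMap f)^[n] ((polyMap f)^[m] p) := fun n =>
    Function.iterate_add_apply _ _ _ _
  have hbig : ∀ n ≥ m, R ≤ ‖(polyMap f)^[n] p‖ := by
    intro n hn
    obtain ⟨k, rfl⟩ := Nat.exists_eq_add_of_le' hn
    rw [hsplit]
    exact hm.trans (hmono _ hm k)
  have hescape : Tendsto (fun n => ‖(polyMap f)^[n] p‖) atTop atTop := by
    rw [← tendsto_add_atTop_iff_nat m]
    simp only [hsplit]
    exact htend _ hm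
  have hlarge : ∀ n ≥ m, c * ‖(polyMap f)^[n] p‖ ^ d ≤ ‖h ((polyMap f)^[n] p)‖ := by
    have hne : ∀ n ≥ m, (polyMap f)^[n] p ≠ 0 := fun n hn =>
      norm_pos_iff.1 (by linarith [hbig n hn])
    intro n hn
    induction n, hn using Nat.le_induction with
    | base => exact hlead _ (hne m le_rfl) (Or.inl hfree)
    | succ n hn ih =>
      refine hlead _ (hne _ (by omega)) (Or.inl fun i => ?_)
      rw [Function.iterate_succ_apply']
      exact (hout _ (hbig n hn) ih i).2.le
  refine ⟨hescape, fun η hη => ?_, ?_⟩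
  · obtain ⟨R', hR'⟩ := (H.eventually_wedge_vertex_le hc hη).exists
    -- The estimate concerns images of points outside the cones, hence the shift by one.
    rw [← map_add_atTop_eq_nat 1, eventually_map]
    filter_upwards [hescape.eventually_ge_atTop R', eventually_ge_atTop m] with n h1 h2
    rw [Function.iterate_succ_apply']
    exact hR' _ h1 (hlarge n h2)
  · have hd1 : (1 : ℝ) ≤ d := Nat.one_le_cast.2 H.degree_pos
    have h1 := tendsto_posLog_posLog_sub_mean (e := fun _ => (d : ℝ)) (C₁ := c * ‖X₀‖ / 2)
      (C₂ := C) hescape (fun _ => hd1) (by positivity) hC (by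
        filter_upwards [eventually_ge_atTop m] with n hn
        rw [Function.iterate_succ_apply', Real.rpow_natCast]
        exact ⟨(hge _ (hbig n hn) (hlarge n hn)).1, hup _ (hR1.trans (hbig n hn))⟩)
    have h2 : Tendsto (escapeSeq f p) atTop (𝓝 (Real.log d)) := by
      have h3 := h1.add_const (Real.log d)
      rw [zero_add] at h3
      refine h3.congr' ?_
      filter_upwards [eventually_gt_atTop 0] with n hn
      have hn' : (n : ℝ) ≠ 0 := Nat.cast_ne_zero.2 hn.ne'
      rw [Finset.sum_const, Finset.card_range, nsmul_eq_mul, escapeSeq]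
      field_simp
      ring
    have h3 := hasEscapeRate_of_tendsto h2
    rwa [Real.exp_log (by linarith)] at h3

end ConeSystem

theorem eventually_coneSystem_indeterminacySet {f : Fin 2 → MvPolynomial (Fin 2) ℂ} {h : C2 → ℂ}
    {X₀ : C2} (H : LeadingForm (polyMap f) h (mapDegree f) X₀)
    (htop : ∀ p, topPart f p = h p • X₀) :
    ∀ᶠ ρ in 𝓝[>] (0 : ℝ), ConeSystem (polyMap f) h (mapDegree f) X₀
      (fun x : indeterminacySet f => affinePart x.1.rep) ρ := by
  have hd := H.degree_pos
  have : Finite (indeterminacySet f) := (finite_nonempty_indeterminacySet H htop).1.to_subtype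
  refine H.eventually_coneSystem (fun x => ?_) (fun x => ?_) (fun p hp hp0 => ?_)
    (fun x y hxy h0 => hxy ?_)
  · exact affinePart_ne_zero x.1.rep_nonzero ((mem_indeterminacySet hd).1 x.2).1
  · have h1 := ((mem_indeterminacySet hd).1 x.2).2
    rw [htop] at h1
    exact (smul_eq_zero.1 h1).resolve_right H.vertex_ne_zero
  · have hmem : (Projectivization.mk ℂ (atInfinity p) (atInfinity_ne_zero hp) : P2) ∈
        indeterminacySet f := by
      rw [mk_mem_indeterminacySet, homLift_atInfinity hd, htop, hp0, zero_smul]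
      ext i; fin_cases i <;> simp [atInfinity]
    refine ⟨⟨_, hmem⟩, ?_⟩
    obtain ⟨t, _, hrep⟩ := exists_smul_rep _ (atInfinity_ne_zero hp)
    change wedge (affinePart (Projectivization.mk ℂ (atInfinity p) _).rep) p = 0
    rw [hrep, affinePart_smul, affinePart_atInfinity, wedge_comm, wedge_smul, wedge_self,
      mul_zero, neg_zero]
  · have hx2 := ((mem_indeterminacySet hd).1 x.2).1
    have hy2 := ((mem_indeterminacySet hd).1 y.2).1
    obtain ⟨t, ht⟩ := eq_smul_of_wedge_eq_zero (affinePart_ne_zero x.1.rep_nonzero hx2) h0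
    apply Subtype.ext
    rw [← Projectivization.mk_rep x.1, ← Projectivization.mk_rep y.1]
    refine ((Projectivization.mk_eq_mk_iff' ℂ _ _ _ _).2 ⟨t, ?_⟩).symm
    rw [← atInfinity_affinePart hx2, ← atInfinity_affinePart hy2, ht, atInfinity_smul]

end EscapeRates

/-! ### The set of escape rates -/

open EscapeRates in
theorem mainTheorem1 (f : Fin 2 → MvPolynomial (Fin 2) ℂ) (d : ℕ)
    (hd : EscapeRates.mapDegree f = d)
    (hattr : EscapeRates.InfinityAttracting f)
    (X : EscapeRates.P2)
    (himage : EscapeRates.imageOfLineAtInfinity f = {X})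
    (hX : X ∉ EscapeRates.indeterminacySet f)
    (V : Set EscapeRates.P2) (hV : V ∈ 𝓝 X) (hVclosed : IsClosed V)
    (hVI : Disjoint V (EscapeRates.indeterminacySet f))
    (ℓ : EscapeRates.P2 → ℝ) (hℓ : EscapeRates.HasLocalExponents f V ℓ) :
    ∃ a b : ℝ,
      IsLeast (ℓ '' EscapeRates.indeterminacySet f) a ∧
      IsGreatest (ℓ '' EscapeRates.indeterminacySet f) b ∧
      b ≤ (d : ℝ) - 1 ∧
      {r : ℝ | ∃ p : EscapeRates.C2,
        EscapeRates.Escapes f p ∧ EscapeRates.upperEscapeRate f p = r}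
          = Set.Icc a b ∪ {(d : ℝ)} ∧
      {r : ℝ | ∃ p : EscapeRates.C2,
        EscapeRates.Escapes f p ∧ EscapeRates.HasEscapeRate f p r}
          = Set.Icc a b ∪ {(d : ℝ)} ∧
      ∀ p : EscapeRates.C2,
        (EscapeRates.upperEscapeRate f p = d ↔ p ∈ EscapeRates.basin f X) ∧
        (EscapeRates.HasEscapeRate f p d ↔ p ∈ EscapeRates.basin f X) := by
  subst hd
  obtain ⟨hX2, h, H, htop⟩ := exists_leadingForm hattr himage hX
  obtain ⟨hfin, hne⟩ := finite_nonempty_indeterminacySet H htop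
  have hdpos := H.degree_pos
  have : Finite (indeterminacySet f) := hfin.to_subtype
  have hℓ1 : ∀ x : indeterminacySet f, 1 ≤ ℓ x := fun x => (hℓ x x.2).1
  choose C₁ hC₁ C₂ hC₂ U hU hbound using fun x : indeterminacySet f => (hℓ x x.2).2
  -- Near infinity, the cone at `x` lies in `U x`, where the exponent is valid, and off `V`. The
  -- local estimate thus applies whenever a point and its image both lie in cones.
  have hcone : ∀ᶠ ρ in 𝓝[>] (0 : ℝ), ∀ x : indeterminacySet f, ∀ᶠ R in atTop, ∀ p : C2,
      R ≤ ‖p‖ → ‖wedge (affinePart x.1.rep) p‖ ≤ ρ * ‖p‖ → toP2 p ∈ U x ∩ Vᶜ :=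
    eventually_all.2 fun x => eventually_toP2_mem ((mem_indeterminacySet hdpos).1 x.2).1
      (inter_mem (hU x) (hVclosed.isOpen_compl.mem_nhds (Set.disjoint_right.1 hVI x.2)))
  obtain ⟨ρ, hcone, H⟩ := (hcone.and (eventually_coneSystem_indeterminacySet H htop)).exists
  set v : indeterminacySet f → C2 := fun x => affinePart x.1.rep with hv
  set X₀ := affinePart X.rep with hX₀
  obtain ⟨D₁, hD₁, hD₁pos⟩ : ∃ D₁ : ℝ, (∀ x, D₁ ≤ C₁ x) ∧ 0 < D₁ := by
    have h1 : ∀ᶠ D in 𝓝[>] (0 : ℝ), ∀ x, D ≤ C₁ x := eventually_all.2 fun x =>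
      mem_nhdsWithin_of_mem_nhds (Iic_mem_nhds (hC₁ x))
    exact (h1.and self_mem_nhdsWithin).exists
  obtain ⟨D₂, hD₂, hD₂pos⟩ : ∃ D₂ : ℝ, (∀ x, C₂ x ≤ D₂) ∧ 0 < D₂ :=
    ((eventually_all.2 fun x => eventually_ge_atTop (C₂ x)).and (eventually_gt_atTop 0)).exists
  obtain ⟨R, hconeR, houtside, htend, hitin, hR1⟩ := ((eventually_all.2 hcone).and
    (H.eventually_escape_outside.and (H.eventually_tendsto_norm_iterate.and
      (H.eventually_exists_itinerary.and (eventually_ge_atTop 1))))).exists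
  obtain ⟨xa, hxa, hmin⟩ := Set.exists_min_image _ ℓ hfin hne
  obtain ⟨xb, hxb, hmax⟩ := Set.exists_max_image _ ℓ hfin hne
  have hstep : ∀ (p : C2) (x y : indeterminacySet f), R ≤ ‖p‖ → ‖wedge (v x) p‖ ≤ ρ * ‖p‖ →
      R ≤ ‖polyMap f p‖ → ‖wedge (v y) (polyMap f p)‖ ≤ ρ * ‖polyMap f p‖ →
      D₁ * ‖p‖ ^ ℓ x ≤ ‖polyMap f p‖ ∧ ‖polyMap f p‖ ≤ D₂ * ‖p‖ ^ ℓ x := by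
    intro p x y hp hpx hfp hfpy
    have h1 := hbound x p (hconeR x p hp hpx).1 (hconeR y _ hfp hfpy).2
    have h2 : 0 ≤ ‖p‖ ^ ℓ x := Real.rpow_nonneg (norm_nonneg p) _
    exact ⟨(mul_le_mul_of_nonneg_right (hD₁ x) h2).trans h1.1,
      h1.2.trans (mul_le_mul_of_nonneg_right (hD₂ x) h2)⟩
  -- Orbits that stay in the cones.
  have hmean : ∀ (p : C2) (i : ℕ → indeterminacySet f), Escapes f p →
      (∀ᶠ n in atTop, ‖wedge (v (i n)) ((polyMap f)^[n] p)‖ ≤ ρ * ‖(polyMap f)^[n] p‖) →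
      Tendsto (fun n : ℕ => escapeSeq f p n -
        (1 / (n : ℝ)) * ∑ k ∈ Finset.range n, Real.log (ℓ (i k))) atTop (𝓝 0) := by
    intro p i hp hi
    refine tendsto_posLog_posLog_sub_mean (e := fun n => ℓ (i n)) hp (fun n => hℓ1 _) hD₁pos
      hD₂pos ?_
    filter_upwards [hi, (tendsto_add_atTop_nat 1).eventually hi, hp.eventually_ge_atTop R,
      (tendsto_add_atTop_nat 1).eventually (hp.eventually_ge_atTop R)] with n h1 h2 h3 h4
    rw [Function.iterate_succ_apply'] at h2 h4 ⊢
    exact hstep _ _ _ h3 h1 h4 h2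
  have hbasin : ∀ (p : C2) (m : ℕ), R ≤ ‖(polyMap f)^[m] p‖ →
      (∀ x, ρ * ‖(polyMap f)^[m] p‖ ≤ ‖wedge (v x) ((polyMap f)^[m] p)‖) →
      Escapes f p ∧ p ∈ basin f X ∧ HasEscapeRate f p (mapDegree f) := by
    intro p m hm hfree
    obtain ⟨h1, h2, h3⟩ := houtside p m hm hfree
    exact ⟨h1, tendsto_toP2_of_wedge_le hX2 h1 h2, h3⟩
  have hvertex : ∀ x, ρ * ‖X₀‖ < ‖wedge (v x) X₀‖ := fun x => by
    have h1 := mul_pos H.opening_pos (norm_pos_iff.2 H.vertex_ne_zero)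
    linarith [H.opening_vertex x]
  have hbasin' : ∀ p ∈ basin f X, HasEscapeRate f p (mapDegree f) := by
    intro p hp
    have h1 : ∀ᶠ n in atTop, ∀ x, ρ * ‖(polyMap f)^[n] p‖ < ‖wedge (v x) ((polyMap f)^[n] p)‖ :=
      eventually_all.2 fun x => eventually_wedge_gt_of_tendsto hp (hvertex x)
    obtain ⟨m, h2, h3⟩ := (h1.and (eventually_norm_gt_of_tendsto hX2 hp R)).exists
    exact (hbasin p m h3.le fun x => (h2 x).le).2.2
  have hdich : ∀ p, Escapes f p → p ∈ basin f X ∨ upperEscapeRate f p ∈ Set.Icc (ℓ xa) (ℓ xb) := by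
    intro p hp
    by_cases hcase : ∃ m, R ≤ ‖(polyMap f)^[m] p‖ ∧
        ∀ x, ρ * ‖(polyMap f)^[m] p‖ ≤ ‖wedge (v x) ((polyMap f)^[m] p)‖
    · obtain ⟨m, h1, h2⟩ := hcase
      exact Or.inl (hbasin p m h1 h2).2.1
    · right
      push Not at hcase
      have h1 : ∀ m, ∃ x, R ≤ ‖(polyMap f)^[m] p‖ →
          ‖wedge (v x) ((polyMap f)^[m] p)‖ ≤ ρ * ‖(polyMap f)^[m] p‖ := by
        intro m
        by_cases hm : R ≤ ‖(polyMap f)^[m] p‖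
        · obtain ⟨x, hx⟩ := hcase m hm
          exact ⟨x, fun _ => hx.le⟩
        · exact ⟨⟨xa, hxa⟩, fun h => absurd h hm⟩
      choose i hi using h1
      have h2 := hmean p i hp ((hp.eventually_ge_atTop R).mono hi)
      have h3 := limsup_mem_Icc_of_tendsto_sub h2 (α := Real.log (ℓ xa)) (β := Real.log (ℓ xb))
        (by
          filter_upwards [eventually_gt_atTop 0] with n hn
          refine mean_mem_Icc (fun k => ?_) hn
          have h4 : 0 < ℓ (i k) := by linarith [hℓ1 (i k)]
          have h5 : 0 < ℓ xa := by linarith [hℓ1 ⟨xa, hxa⟩]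
          exact ⟨Real.log_le_log h5 (hmin _ (i k).2), Real.log_le_log h4 (hmax _ (i k).2)⟩)
      have ha : 0 < ℓ xa := by linarith [hℓ1 ⟨xa, hxa⟩]
      have hb : 0 < ℓ xb := by linarith [hℓ1 ⟨xb, hxb⟩]
      exact ⟨(Real.log_le_iff_le_exp ha).1 h3.1, (Real.le_log_iff_exp_le hb).1 h3.2⟩
  have hbd : ℓ xb ≤ (mapDegree f : ℝ) - 1 := by
    by_contra! hlt
    set δ := ℓ xb - ((mapDegree f : ℝ) - 1) with hδ
    have hδpos : 0 < δ := sub_pos.2 hlt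
    -- The constant itinerary at `xb` gives arbitrarily large `p` with `p` and `f(p)` in that cone.
    -- Then `D₁ * ‖p‖ ^ b ≤ C * ‖p‖ ^ (d - 1)`, which fails for large `‖p‖` if `b > d - 1`.
    obtain ⟨C, hC, hle⟩ := H.exists_norm_map_le_of_mem_cone ⟨xb, hxb⟩
    obtain ⟨M, hM⟩ := eventually_atTop.1 ((tendsto_rpow_atTop hδpos).eventually_gt_atTop (C / D₁))
    obtain ⟨R', ⟨hitin', hmono⟩, hR'⟩ := ((H.eventually_exists_itinerary.and
      H.eventually_norm_iterate_ge).and (eventually_ge_atTop (max M R))).exists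
    obtain ⟨p, hp, hpc⟩ := hitin' fun _ => ⟨xb, hxb⟩
    have hpR : R ≤ ‖p‖ := (le_max_right M R).trans (hR'.trans hp)
    have hpM : M ≤ ‖p‖ := (le_max_left M R).trans (hR'.trans hp)
    have hp0 : 0 < ‖p‖ := by linarith
    have h1 : ‖wedge (v ⟨xb, hxb⟩) (polyMap f p)‖ ≤ ρ * ‖polyMap f p‖ := hpc 1
    have h2 := (hstep p ⟨xb, hxb⟩ ⟨xb, hxb⟩ hpR (hpc 0) (hpR.trans (hmono p hp 1)) h1).1
    have h3 := hle p (hR1.trans hpR) h1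
    have h4 : ‖p‖ ^ ℓ xb = ‖p‖ ^ δ * ‖p‖ ^ (mapDegree f - 1) := by
      rw [← Real.rpow_natCast, ← Real.rpow_add hp0, Nat.cast_pred hdpos, hδ, sub_add_cancel]
    have h5 := (div_lt_iff₀ hD₁pos).1 (hM _ hpM)
    have h6 : 0 < ‖p‖ ^ (mapDegree f - 1) := by positivity
    have h7 : D₁ * ‖p‖ ^ ℓ xb ≤ C * ‖p‖ ^ (mapDegree f - 1) := h2.trans h3
    rw [h4] at h7
    nlinarith
  have hone : ∀ p, ¬ Escapes f p → upperEscapeRate f p = 1 := by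
    intro p hp
    -- An orbit that once exceeds `R` escapes, so one that does not escape is bounded by `R`.
    refine upperEscapeRate_eq_one_of_bounded (R := R) fun n => ?_
    by_contra! hn
    refine hp ((tendsto_add_atTop_iff_nat n).1 ?_)
    simp only [Function.iterate_add_apply]
    exact htend _ hn.le
  have hreal : ∀ r ∈ Set.Icc (ℓ xa) (ℓ xb), ∃ p, Escapes f p ∧ HasEscapeRate f p r := by
    intro r hr
    have ha : 0 < ℓ xa := by linarith [hℓ1 ⟨xa, hxa⟩]
    have hr0 : 0 < r := ha.trans_le hr.1
    obtain ⟨s, hs⟩ := exists_tendsto_mean (α := Real.log (ℓ xa)) (β := Real.log (ℓ xb))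
      (r := Real.log r) ⟨Real.log_le_log ha hr.1, Real.log_le_log hr0 hr.2⟩
    set i : ℕ → indeterminacySet f := fun k => if s k then ⟨xb, hxb⟩ else ⟨xa, hxa⟩ with hi
    obtain ⟨p, hp, hpi⟩ := hitin i
    have hesc : Escapes f p := htend p hp
    have h1 := (hmean p i hesc (Eventually.of_forall hpi)).add hs
    rw [zero_add] at h1
    have h2 : Tendsto (escapeSeq f p) atTop (𝓝 (Real.log r)) := by
      refine h1.congr fun n => ?_
      have h3 : ∀ k, Real.log (ℓ (i k)) = if s k then Real.log (ℓ xb) else Real.log (ℓ xa) := by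
        intro k
        by_cases hk : s k <;> simp [hi, hk]
      simp only [h3, sub_add_cancel]
    have h3 := hasEscapeRate_of_tendsto h2
    rw [Real.exp_log hr0] at h3
    exact ⟨p, hesc, h3⟩
  have hrealTop : ∃ p, Escapes f p ∧ HasEscapeRate f p (mapDegree f) := by
    have hX₀pos : 0 < ‖X₀‖ := norm_pos_iff.2 H.vertex_ne_zero
    have hn : ‖((R / ‖X₀‖ : ℝ) : ℂ)‖ = R / ‖X₀‖ := by
      rw [Complex.norm_real, Real.norm_of_nonneg (by positivity)]
    obtain ⟨h1, _, h3⟩ := hbasin (((R / ‖X₀‖ : ℝ) : ℂ) • X₀) 0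
      (by rw [Function.iterate_zero, id, norm_smul, hn, div_mul_cancel₀ _ hX₀pos.ne'])
      (fun x => by
        rw [Function.iterate_zero, id, norm_smul, wedge_smul, norm_mul, hn, mul_left_comm]
        exact mul_le_mul_of_nonneg_left (hvertex x).le (by positivity))
    exact ⟨_, h1, h3⟩
  have hupper : ∀ p, Escapes f p →
      upperEscapeRate f p ∈ Set.Icc (ℓ xa) (ℓ xb) ∪ {(mapDegree f : ℝ)} := fun p hp =>
    (hdich p hp).symm.imp id fun hpb => (hbasin' p hpb).2
  have hrates : ∀ r ∈ Set.Icc (ℓ xa) (ℓ xb) ∪ {(mapDegree f : ℝ)},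
      ∃ p, Escapes f p ∧ HasEscapeRate f p r := by
    rintro r (hr | rfl)
    · exact hreal r hr
    · exact hrealTop
  have hiff : ∀ p, upperEscapeRate f p = mapDegree f → p ∈ basin f X := by
    intro p hp
    have h1 := hℓ1 ⟨xb, hxb⟩
    -- Outside the basin the upper rate is at most `b ≤ d - 1` if `p` escapes, and 1 otherwise; `1 ≤
    -- b ≤ d - 1` excludes `d = 1`.
    by_cases hesc : Escapes f p
    · refine (hdich p hesc).resolve_right fun h2 => ?_
      have := h2.2
      linarith
    · rw [hone p hesc] at hp
      linarith
  refine ⟨ℓ xa, ℓ xb, ⟨⟨xa, hxa, rfl⟩, ?_⟩, ⟨⟨xb, hxb, rfl⟩, ?_⟩, hbd, ?_, ?_, fun p =>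
    ⟨⟨hiff p, fun hp => (hbasin' p hp).2⟩, fun hp => hiff p hp.2, hbasin' p⟩⟩
  · rintro _ ⟨x, hx, rfl⟩
    exact hmin x hx
  · rintro _ ⟨x, hx, rfl⟩
    exact hmax x hx
  · ext r
    constructor
    · rintro ⟨p, hp, rfl⟩
      exact hupper p hp
    · intro hr
      obtain ⟨p, hp, hpr⟩ := hrates r hr
      exact ⟨p, hp, hpr.2⟩
  · ext r
    constructor
    · rintro ⟨p, hp, hpr⟩
      rw [← hpr.2]
      exact hupper p hp
    · exact hrates r
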